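/- Let $M$ be a smooth manifold of dimension $4n$ with a smooth $\mathrm{Sp}(1)\mathrm{GL}(n,\mathbb H)$-structure $Q$ that admits a smooth torsion-free connection (a quaternionic manifold). Here $\mathrm{Sp}(1)\mathrm{GL}(n,\mathbb H)$ is the group of real-linear automorphisms $v\mapsto qA(v)$ of the left $\mathbb H$-module $\mathbb H^n$, with $q$ a unit quaternion and $A$ an $\mathbb H$-linear automorphism, and $Q$ is a principal subbundle, with this structure group, of the bundle of frames $u:\mathbb H^n\to T_xM$ (real-linear isomorphisms). A frame $u\in Q_x$ transports left multiplication by the imaginary quaternions to $T_xM$, and so gives an action of $\mathfrak{sp}(1)=\langle I,J,K\rangle$ on the space $\Lambda^kT_x^*M$ of complex-valued $k$-covectors (the dual action on covectors, extended by the Leibniz rule). Let $V_r$ be the irreducible complex representation of $\mathrm{Sp}(1)$ with highest weight $r$, let $(E_{k,r})_x\subseteq\Lambda^kT_x^*M$ be the sum of all irreducible subrepresentations isomorphic to $V_r$ (so $E_{k,r}=0$ for $r<0$), and let $\mathcal C=I^2+J^2+K^2$ be the Casimir operator; neither depends on the choice of $u\in Q_x$. Then $\Lambda^{k+1}T_x^*M=\bigoplus_{s}(E_{k+1,s})_x$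 for every $x\in M$; let $\pi_{k+1,s}$ be the projection onto $E_{k+1,s}$ along the other summands. For sections $\alpha$ of $E_{k,r}$ put $$\mathcal D\alpha=\pi_{k+1,r+1}(d\alpha),\qquad \overline{\mathcal D}\alpha=\pi_{k+1,r-1}(d\alpha).$$ Let $k,r\ge 0$ be integers and let $\alpha$ be a smooth complex-valued (in particular, possibly real-valued) $k$-form on $M$ that is a section of $E_{k,r}$. Then $$\mathcal D\alpha=-\frac14\left((r-1)+\frac1{r+1}(I^2+J^2+K^2)\right)d\alpha \qquad\text{and}\qquad \overline{\mathcal D}\alpha=\frac14\left((r+3)+\frac1{r+1}(I^2+J^2+K^2)\right)d\alpha .$$ -/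

import Mathlib

open scoped Manifold ContDiff Quaternion Topology

noncomputable section

namespace QuaternionicForms

/-! ### The model: `ℍⁿ` and the group `Sp(1)GL(n,ℍ)` -/

/-- The space `ℍⁿ`, a left `ℍ`-module by `(q • v) i = q * v i`. -/
abbrev HSpace (n : ℕ) : Type := Fin n → ℍ[ℝ]

/-- Membership in `Sp(1)GL(n,ℍ)`: the real-linear automorphisms `v ↦ q • A v` of `ℍⁿ`, with `q` a
unit quaternion and `A` an automorphism of the left `ℍ`-module `ℍⁿ` (that is, right multiplication
of row vectors by an invertible quaternionic matrix). -/
def IsSpGL {n : ℕ} (g : HSpace n ≃L[ℝ] HSpace n) : Prop :=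
  ∃ q : ℍ[ℝ], ‖q‖ = 1 ∧ ∃ A : HSpace n ≃ₗ[ℍ[ℝ]] HSpace n, ∀ v, g v = q • A v

/-- Membership in the Lie algebra `𝔰𝔭(1) + 𝔤𝔩(n,ℍ)` of `Sp(1)GL(n,ℍ)`: the real-linear maps
`v ↦ p • v + A v`, with `p` an imaginary quaternion and `A` left `ℍ`-linear. -/
def IsSpGLAlgebra {n : ℕ} (B : HSpace n → HSpace n) : Prop :=
  ∃ p : ℍ[ℝ], p.re = 0 ∧ ∃ A : HSpace n →ₗ[ℍ[ℝ]] HSpace n, ∀ v, B v = p • v + A v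

/-- Multiplication by `p` on the left of `ℍⁿ`, as a continuous real-linear map. -/
def leftMul (n : ℕ) (p : ℍ[ℝ]) : HSpace n →L[ℝ] HSpace n :=
  LinearMap.toContinuousLinearMap
    { toFun := fun v => p • v
      map_add' := fun v w => smul_add p v w
      map_smul' := fun c v => smul_comm p c v }

/-! ### The action of `𝔰𝔭(1)` on exterior forms on one vector space -/

section Fibre

variable {V : Type*} [AddCommGroup V] [Module ℝ V] [TopologicalSpace V] {n k : ℕ}

/-- The underlying multilinear form of the action of an endomorphism on an alternating form. -/
def formActionAux (A : V →L[ℝ] V) (β : V [⋀^Fin k]→L[ℝ] ℂ) :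
    ContinuousMultilinearMap ℝ (fun _ : Fin k => V) ℂ :=
  -∑ j : Fin k, β.toContinuousMultilinearMap.compContinuousLinearMap
    (fun i => if i = j then A else ContinuousLinearMap.id ℝ V)

theorem formActionAux_apply (A : V →L[ℝ] V) (β : V [⋀^Fin k]→L[ℝ] ℂ) (v : Fin k → V) :
    formActionAux A β v = -∑ j : Fin k, β (Function.update v j (A (v j))) := by
  simp only [formActionAux, neg_apply, sum_apply,
    ContinuousMultilinearMap.compContinuousLinearMap_apply,
    ContinuousAlternatingMap.coe_toContinuousMultilinearMap]
  congr 1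
  refine Finset.sum_congr rfl fun j _ => ?_
  congr 1
  funext i
  by_cases h : i = j
  · subst h; simp
  · simp [h]

theorem formActionAux_alternating (A : V →L[ℝ] V) (β : V [⋀^Fin k]→L[ℝ] ℂ) (v : Fin k → V)
    (a b : Fin k) (hv : v a = v b) (hab : a ≠ b) : formActionAux A β v = 0 := by
  rw [formActionAux_apply, neg_eq_zero,
    ← Finset.add_sum_erase _ _ (Finset.mem_univ a),
    ← Finset.add_sum_erase _ _ (Finset.mem_erase.2 ⟨hab.symm, Finset.mem_univ b⟩),
    Finset.sum_eq_zero, add_zero]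
  · have h : Function.update v b (A (v b)) =
        Function.update v a (A (v a)) ∘ Equiv.swap a b := by
      funext i
      by_cases hia : i = a
      · subst hia; simp [Function.update_of_ne hab, Function.update_of_ne hab.symm, hv]
      · by_cases hib : i = b
        · subst hib; simp [hv]
        · simp [Equiv.swap_apply_of_ne_of_ne hia hib, hia, hib]
    rw [h]
    have := β.toAlternatingMap.map_swap (Function.update v a (A (v a))) hab
    simp only [ContinuousAlternatingMap.coe_toAlternatingMap] at this
    rw [this, add_neg_cancel]
  · intro j hj
    simp only [Finset.mem_erase, Finset.mem_univ, and_true] at hj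
    refine β.map_eq_zero_of_eq _ ?_ hab
    rw [Function.update_of_ne hj.2.symm, Function.update_of_ne hj.1.symm, hv]

/-- The action of an endomorphism `A` of `V` on complex-valued alternating `k`-forms,
`(A β)(v₁, …, v_k) = - ∑ j, β(v₁, …, A v_j, …, v_k)`: the dual action on covectors, extended to
forms by the Leibniz rule. -/
def formAction (A : V →L[ℝ] V) :
    (V [⋀^Fin k]→L[ℝ] ℂ) →ₗ[ℂ] (V [⋀^Fin k]→L[ℝ] ℂ) where
  toFun β :=
    { toContinuousMultilinearMap := formActionAux A β
      map_eq_zero_of_eq' := fun v a b hv hab => formActionAux_alternating A β v a b hv hab }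
  map_add' β γ := by
    ext v
    change formActionAux A (β + γ) v = formActionAux A β v + formActionAux A γ v
    simp only [formActionAux_apply, ContinuousAlternatingMap.add_apply, Finset.sum_add_distrib,
      neg_add]
  map_smul' c β := by
    ext v
    change formActionAux A (c • β) v = c • formActionAux A β v
    simp only [formActionAux_apply, ContinuousAlternatingMap.smul_apply, smul_neg,
      Finset.smul_sum]

theorem formAction_apply (A : V →L[ℝ] V) (β : V [⋀^Fin k]→L[ℝ] ℂ) (v : Fin k → V) :
    formAction A β v = -∑ j : Fin k, β (Function.update v j (A (v j))) :=
  formActionAux_apply A β v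

/-- A frame `u : ℍⁿ ≅ V` transports left multiplication by the quaternion `p` to `V`. -/
def quatEnd (u : HSpace n ≃L[ℝ] V) (p : ℍ[ℝ]) : V →L[ℝ] V :=
  (u : HSpace n →L[ℝ] V) ∘L leftMul n p ∘L (u.symm : V →L[ℝ] HSpace n)

/-- The action of the Lie algebra `𝔰𝔭(1)` of imaginary quaternions on `k`-forms on `V`, through a
frame `u`. -/
def sp1Action (u : HSpace n ≃L[ℝ] V) (p : ℍ[ℝ]) :
    (V [⋀^Fin k]→L[ℝ] ℂ) →ₗ[ℂ] (V [⋀^Fin k]→L[ℝ] ℂ) :=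
  formAction (quatEnd u p)

/-- The quaternion unit `i`. -/
def qi : ℍ[ℝ] := ⟨0, 1, 0, 0⟩
/-- The quaternion unit `j`. -/
def qj : ℍ[ℝ] := ⟨0, 0, 1, 0⟩
/-- The quaternion unit `k`. -/
def qk : ℍ[ℝ] := ⟨0, 0, 0, 1⟩

/-- The Casimir operator `I² + J² + K²` on `k`-forms. -/
def casimir (u : HSpace n ≃L[ℝ] V) :
    (V [⋀^Fin k]→L[ℝ] ℂ) →ₗ[ℂ] (V [⋀^Fin k]→L[ℝ] ℂ) :=
  sp1Action u qi ∘ₗ sp1Action u qi + sp1Action u qj ∘ₗ sp1Action u qj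
    + sp1Action u qk ∘ₗ sp1Action u qk

/-- `W` is a subrepresentation. As `Sp(1)` is connected, the subspaces invariant under `Sp(1)` are
those invariant under `𝔰𝔭(1)`. -/
def IsSubrep (u : HSpace n ≃L[ℝ] V) (W : Submodule ℂ (V [⋀^Fin k]→L[ℝ] ℂ)) : Prop :=
  ∀ p : ℍ[ℝ], p.re = 0 → ∀ w ∈ W, sp1Action u p w ∈ W

/-- `W` is an irreducible subrepresentation. -/
def IsIrredSubrep (u : HSpace n ≃L[ℝ] V) (W : Submodule ℂ (V [⋀^Fin k]→L[ℝ] ℂ)) : Prop :=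
  IsSubrep u W ∧ W ≠ ⊥ ∧ ∀ W' ≤ W, IsSubrep u W' → W' = ⊥ ∨ W' = W

/-- The weights of `W`: the integers `m` such that `I` has the eigenvalue `m √-1` on `W`. -/
def weights (u : HSpace n ≃L[ℝ] V) (W : Submodule ℂ (V [⋀^Fin k]→L[ℝ] ℂ)) : Set ℤ :=
  {m | ∃ w ∈ W, w ≠ 0 ∧ sp1Action u qi w = ((m : ℂ) * Complex.I) • w}

/-- The sum of all irreducible subrepresentations with highest weight `r` (those isomorphic to
`V_r`) in the `k`-forms on `V`. It is zero for `r < 0`. -/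
def isotypic (k : ℕ) (r : ℤ) (u : HSpace n ≃L[ℝ] V) : Submodule ℂ (V [⋀^Fin k]→L[ℝ] ℂ) :=
  sSup {W | IsIrredSubrep u W ∧ IsGreatest (weights u W) r}

end Fibre

/-! ### Differential forms on a manifold -/

section Manifold

variable {n k : ℕ} {M : Type*} [TopologicalSpace M]
  [ChartedSpace (EuclideanSpace ℝ (Fin (4 * n))) M]

/-- Complex-valued `k`-covectors at the point `x` of a `4n`-dimensional manifold. -/
abbrev Covector (n k : ℕ) {M : Type*} [TopologicalSpace M]
    [ChartedSpace (EuclideanSpace ℝ (Fin (4 * n))) M] (x : M) : Type :=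
  (TangentSpace (𝓡 (4 * n)) x) [⋀^Fin k]→L[ℝ] ℂ

/-- The expression of a `k`-form in the preferred chart at `x`: its pullback by the inverse chart. -/
def inChart (α : ∀ x : M, Covector n k x) (x : M) (y : EuclideanSpace ℝ (Fin (4 * n))) :
    EuclideanSpace ℝ (Fin (4 * n)) [⋀^Fin k]→L[ℝ] ℂ :=
  (α ((extChartAt (𝓡 (4 * n)) x).symm y)).compContinuousLinearMap
    (mfderiv 𝓘(ℝ, EuclideanSpace ℝ (Fin (4 * n))) (𝓡 (4 * n)) (extChartAt (𝓡 (4 * n)) x).symm y)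

/-- A `k`-form is smooth if its expressions in the charts are. -/
def IsSmoothForm (α : ∀ x : M, Covector n k x) : Prop :=
  ∀ x : M, ContDiffOn ℝ ∞ (inChart α x) (extChartAt (𝓡 (4 * n)) x).target

/-- The exterior derivative on `M`: at `x`, the pullback by the preferred chart at `x` of the
exterior derivative of the expression of `α` in that chart. -/
def extD (α : ∀ x : M, Covector n k x) (x : M) : Covector n (k + 1) x :=
  (extDeriv (inChart α x) (extChartAt (𝓡 (4 * n)) x x)).compContinuousLinearMap
    (mfderiv (𝓡 (4 * n)) 𝓘(ℝ, EuclideanSpace ℝ (Fin (4 * n))) (extChartAt (𝓡 (4 * n)) x) x)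

/-- A field of frames `s` is smooth on `U` if all the vector fields `s v`, `v ∈ ℍⁿ`, are. -/
def IsSmoothFrameOn [IsManifold (𝓡 (4 * n)) ∞ M]
    (s : ∀ x : M, HSpace n ≃L[ℝ] TangentSpace (𝓡 (4 * n)) x) (U : Set M) : Prop :=
  ∀ v : HSpace n, ContMDiffOn (𝓡 (4 * n)) (𝓡 (4 * n)).tangent ∞
    (fun x => (⟨x, s x v⟩ : TangentBundle (𝓡 (4 * n)) M)) U

end Manifold

/-! ### Quaternionic manifolds -/

/-- An `Sp(1)GL(n,ℍ)`-structure on a `4n`-manifold: a principal subbundle, with structure group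
`Sp(1)GL(n,ℍ)`, of the bundle of frames `ℍⁿ ≅ T_x M`. -/
structure SpGLStructure (n : ℕ) (M : Type*) [TopologicalSpace M]
    [ChartedSpace (EuclideanSpace ℝ (Fin (4 * n))) M] [IsManifold (𝓡 (4 * n)) ∞ M] where
  /-- The frames at `x` that belong to the structure. -/
  frames : ∀ x : M, Set (HSpace n ≃L[ℝ] TangentSpace (𝓡 (4 * n)) x)
  /-- The fibre over `x` is an orbit of the group. -/
  mem_frames_iff : ∀ x, ∀ u ∈ frames x, ∀ u' : HSpace n ≃L[ℝ] TangentSpace (𝓡 (4 * n)) x,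
    u' ∈ frames x ↔ ∃ g : HSpace n ≃L[ℝ] HSpace n, IsSpGL g ∧ u' = g.trans u
  /-- There are smooth local sections around every point. -/
  exists_section : ∀ x₀ : M, ∃ U : Set M, IsOpen U ∧ x₀ ∈ U ∧
    ∃ s : ∀ x : M, HSpace n ≃L[ℝ] TangentSpace (𝓡 (4 * n)) x,
      (∀ x ∈ U, s x ∈ frames x) ∧ IsSmoothFrameOn s U

namespace SpGLStructure

variable {n : ℕ} {M : Type*} [TopologicalSpace M]
  [ChartedSpace (EuclideanSpace ℝ (Fin (4 * n))) M] [IsManifold (𝓡 (4 * n)) ∞ M]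

/-- The linear connection `∇` is a connection on the structure `Q`: in every smooth local section
`s` of `Q`, its connection form `X ↦ s⁻¹ ∇_X s` has values in the Lie algebra of
`Sp(1)GL(n,ℍ)`. -/
def IsPreservedBy (Q : SpGLStructure n M)
    (cov : CovariantDerivative (𝓡 (4 * n)) (EuclideanSpace ℝ (Fin (4 * n)))
      (TangentSpace (𝓡 (4 * n)) : M → Type _)) : Prop :=
  ∀ (U : Set M) (s : ∀ x : M, HSpace n ≃L[ℝ] TangentSpace (𝓡 (4 * n)) x),
    IsOpen U → (∀ x ∈ U, s x ∈ Q.frames x) → IsSmoothFrameOn s U →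
    ∀ x ∈ U, ∀ X : TangentSpace (𝓡 (4 * n)) x,
      IsSpGLAlgebra fun v => (s x).symm (cov (fun y => s y v) x X)

/-- `(M, Q)` is a quaternionic manifold: `Q` admits a smooth torsion-free connection. -/
def IsQuaternionic (Q : SpGLStructure n M) : Prop :=
  ∃ cov : CovariantDerivative (𝓡 (4 * n)) (EuclideanSpace ℝ (Fin (4 * n)))
      (TangentSpace (𝓡 (4 * n)) : M → Type _),
    cov.ContMDiffCovariantDerivative ∞ ∧ cov.torsion = 0 ∧ Q.IsPreservedBy cov

/-- The fibre at `x` of the bundle `E_{k,r}`: the `k`-covectors lying in the sum of the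
`Sp(1)`-subrepresentations with highest weight `r`. Two frames of `Q` at `x` give `𝔰𝔭(1)`-actions
which differ by an automorphism of `𝔰𝔭(1)`, so this sum is the same for all frames. -/
def E (Q : SpGLStructure n M) (k : ℕ) (r : ℤ) (x : M) : Submodule ℂ (Covector n k x) :=
  ⨅ u ∈ Q.frames x, isotypic k r u

/-- `E_{k,r}` and the sum of the other `E_{k,s}` are complementary in the `k`-covectors at `x`. -/
def Splits (Q : SpGLStructure n M) (k : ℕ) (r : ℤ) (x : M) : Prop :=
  IsCompl (Q.E k r x) (⨆ s : {s : ℤ // s ≠ r}, Q.E k s x)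

open Classical in
/-- The projection `π_{k,r}` of the `k`-covectors at `x` onto `E_{k,r}`, along the sum of the other
`E_{k,s}`. -/
def proj (Q : SpGLStructure n M) (k : ℕ) (r : ℤ) (x : M) :
    Covector n k x →ₗ[ℂ] Covector n k x :=
  if h : Q.Splits k r x then Submodule.projection _ _ h else 0

/-- `α` is a smooth section of `E_{k,r}`. -/
def IsSmoothSection (Q : SpGLStructure n M) (k : ℕ) (r : ℤ) (α : ∀ x : M, Covector n k x) : Prop :=
  IsSmoothForm α ∧ ∀ x, α x ∈ Q.E k r x

/-- The operator `𝒟 = π_{k+1,r+1} ∘ d`, to be applied to sections of `E_{k,r}`. -/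
def D (Q : SpGLStructure n M) {k : ℕ} (r : ℤ) (α : ∀ x : M, Covector n k x) (x : M) :
    Covector n (k + 1) x :=
  Q.proj (k + 1) (r + 1) x (extD α x)

/-- The operator `𝒟̄ = π_{k+1,r-1} ∘ d`, to be applied to sections of `E_{k,r}`. -/
def Dbar (Q : SpGLStructure n M) {k : ℕ} (r : ℤ) (α : ∀ x : M, Covector n k x) (x : M) :
    Covector n (k + 1) x :=
  Q.proj (k + 1) (r - 1) x (extD α x)

end SpGLStructure

end QuaternionicForms

end

/-! The operators $\mathcal D$ and $\overline{\mathcal D}$ can be recovered from $d\alpha$ and its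
Casimir image because $d\alpha$ has only two isotypic components, on which the Casimir operator $C$
takes different values.

For a torsion-free connection preserving $Q$, $d\alpha$ is the alternation of $\nabla\alpha$, and
$\nabla\alpha$ at a point lies in $T^*\otimes E_{k,r}$. Under $\mathfrak{sp}(1)$, complexified
covectors are a multiple of $V_1$, and $V_1\otimes V_r=V_{r+1}\oplus V_{r-1}$. Alternation is
equivariant, so only the weights $r\pm1$ occur. Since $C$ equals $-s(s+2)$ on $V_s$, with $c_\pm$
its values for $s=r\pm1$ one has $c_+-c_-=-4(r+1)$. Solving $d\alpha=\mathcal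
D\alpha+\overline{\mathcal D}\alpha$ and $C\,d\alpha=c_+\mathcal D\alpha+c_-\overline{\mathcal
D}\alpha$ gives both formulas.

The Clebsch–Gordan step is carried out as a quadratic identity, $(C-c_+)(C-c_-)d\alpha=0$: pointwise
algebra is in `casimir_casimir_alternatizeUncurryFin`, and the passage to $d\alpha$ is in
`exists_extDeriv_eq_alternatizeUncurryFin` and `casimir_casimir_extD`. Isotypic components are
identified with Casimir eigenspaces in `isotypic_of_nonneg`, which rests on complete reducibility
(`IsSubrep.le_sSup_irred`) and on highest weight vectors (`exists_highest`). The final linear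
algebra is `proj_eq_of_casimir_casimir`. -/

noncomputable section

namespace QuaternionicForms

/-! ### Endomorphisms acting on alternating forms. -/

section FormAction

variable {V V' : Type*} [AddCommGroup V] [Module ℝ V] [TopologicalSpace V]
  [AddCommGroup V'] [Module ℝ V'] [TopologicalSpace V'] {n k : ℕ}

theorem formAction_add [ContinuousAdd V] (A B : V →L[ℝ] V) (β : V [⋀^Fin k]→L[ℝ] ℂ) :
    formAction (A + B) β = formAction A β + formAction B β := by
  ext v
  simp [formAction_apply, ContinuousAlternatingMap.map_update_add, Finset.sum_add_distrib, add_comm]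

theorem formAction_smul [ContinuousConstSMul ℝ V] (c : ℝ) (A : V →L[ℝ] V)
    (β : V [⋀^Fin k]→L[ℝ] ℂ) : formAction (c • A) β = c • formAction A β := by
  ext v
  simp [formAction_apply, ContinuousAlternatingMap.map_update_smul, Finset.mul_sum]

/-- The action of endomorphisms on forms is a representation of the commutator Lie algebra. -/
theorem formAction_comm [IsTopologicalAddGroup V] (A B : V →L[ℝ] V) (β : V [⋀^Fin k]→L[ℝ] ℂ) :
    formAction A (formAction B β) - formAction B (formAction A β) =
      formAction (A ∘L B - B ∘L A) β := by
  ext v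
  have key : ∀ A B : V →L[ℝ] V, formAction A (formAction B β) v =
      (∑ j, β (Function.update v j (B (A (v j))))) +
      ∑ j, ∑ l ∈ Finset.univ.erase j,
        β (Function.update (Function.update v j (A (v j))) l (B (v l))) := by
    intro A B
    rw [formAction_apply]
    simp only [formAction_apply]
    rw [Finset.sum_neg_distrib, neg_neg, ← Finset.sum_add_distrib]
    refine Finset.sum_congr rfl fun j _ => ?_
    rw [← Finset.add_sum_erase _ _ (Finset.mem_univ j)]
    congr 1
    · simp
    · refine Finset.sum_congr rfl fun l hl => ?_
      rw [Function.update_of_ne (Finset.ne_of_mem_erase hl)]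
  rw [ContinuousAlternatingMap.sub_apply, key, key]
  -- Substitutions into two different slots commute, so these terms cancel in the commutator and
  -- only the terms hitting one slot twice remain.
  have hsymm : (∑ j, ∑ l ∈ Finset.univ.erase j,
        β (Function.update (Function.update v j (A (v j))) l (B (v l)))) =
      ∑ j, ∑ l ∈ Finset.univ.erase j,
        β (Function.update (Function.update v j (B (v j))) l (A (v l))) := by
    rw [Finset.sum_comm' (t' := Finset.univ) (s' := fun l => Finset.univ.erase l)]
    · refine Finset.sum_congr rfl fun j _ => Finset.sum_congr rfl fun l hl => ?_
      rw [Function.update_comm (Finset.ne_of_mem_erase hl)]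
    · intro x y
      simp [eq_comm]
  rw [hsymm, formAction_apply, add_sub_add_right_eq_sub, ← Finset.sum_sub_distrib,
    ← Finset.sum_neg_distrib]
  refine Finset.sum_congr rfl fun j _ => ?_
  rw [sub_apply, ContinuousAlternatingMap.map_update_sub]
  simp

theorem formAction_compContinuousLinearMap (L : V' →L[ℝ] V) (A : V →L[ℝ] V) (A' : V' →L[ℝ] V')
    (h : ∀ v, L (A' v) = A (L v)) (β : V [⋀^Fin k]→L[ℝ] ℂ) :
    formAction A' (β.compContinuousLinearMap L) =
      (formAction A β).compContinuousLinearMap L := by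
  ext v
  simp only [formAction_apply, ContinuousAlternatingMap.compContinuousLinearMap_apply,
    Function.comp_def]
  congr 1
  refine Finset.sum_congr rfl fun j _ => ?_
  congr 1
  funext i
  by_cases hi : i = j
  · subst hi; simp [h]
  · simp [hi]

end FormAction

/-! ### Equivariance of alternation. -/

section Alternatize

variable {E : Type*} [NormedAddCommGroup E] [NormedSpace ℝ E] {k : ℕ}

/-- The hypothesis says that `ψ'` is the Leibniz action of `A` on `ψ` as an element of
$T^*\otimes\Lambda^k$. For each term of the alternation, the slot fed to the covector factor gives
$-\psi(A\,\cdot)$ and the other slots give the action on the values. -/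
theorem formAction_alternatizeUncurryFin (A : E →L[ℝ] E)
    (ψ ψ' : E →L[ℝ] E [⋀^Fin k]→L[ℝ] ℂ)
    (h : ∀ w, ψ' w = formAction A (ψ w) - ψ (A w)) :
    formAction A (ContinuousAlternatingMap.alternatizeUncurryFin ψ) =
      ContinuousAlternatingMap.alternatizeUncurryFin ψ' := by
  ext v
  simp only [formAction_apply, ContinuousAlternatingMap.alternatizeUncurryFin_apply, h,
    ContinuousAlternatingMap.sub_apply]
  rw [Finset.sum_comm, ← Finset.sum_neg_distrib]
  refine Finset.sum_congr rfl fun i _ => ?_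
  rw [Fin.sum_univ_succAbove _ i, ← Finset.smul_sum]
  have h1 : ∀ j, ψ (Function.update v (i.succAbove j) (A (v (i.succAbove j))) i)
      (i.removeNth (Function.update v (i.succAbove j) (A (v (i.succAbove j))))) =
      ψ (v i) (Function.update (i.removeNth v) j (A (i.removeNth v j))) := by
    intro j
    rw [Function.update_of_ne (Fin.succAbove_ne i j).symm, Fin.removeNth_update_succAbove]
    rfl
  simp only [h1, Function.update_self, Fin.removeNth_update, ← Finset.smul_sum]
  rw [← smul_add, ← smul_neg]
  congr 1
  abel

end Alternatize

/-! ### The quaternionic action, its Casimir operator and changes of frame. -/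

section Sp1

variable {V V' : Type*} [AddCommGroup V] [Module ℝ V] [TopologicalSpace V]
  [AddCommGroup V'] [Module ℝ V'] [TopologicalSpace V'] {n k : ℕ}

theorem quatEnd_apply (u : HSpace n ≃L[ℝ] V) (p : ℍ[ℝ]) (v : V) :
    quatEnd u p v = u (p • u.symm v) := rfl

variable (u : HSpace n ≃L[ℝ] V)

theorem quatEnd_mul (p q : ℍ[ℝ]) : quatEnd u (p * q) = quatEnd u p ∘L quatEnd u q := by
  ext v
  simp [quatEnd_apply, mul_smul]

theorem quatEnd_add [IsTopologicalAddGroup V] (p q : ℍ[ℝ]) :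
    quatEnd u (p + q) = quatEnd u p + quatEnd u q := by
  ext v
  simp [quatEnd_apply, add_smul]

theorem quatEnd_sub [IsTopologicalAddGroup V] (p q : ℍ[ℝ]) :
    quatEnd u (p - q) = quatEnd u p - quatEnd u q := by
  ext v
  simp [quatEnd_apply, sub_smul]

theorem quatEnd_smul [ContinuousSMul ℝ V] (c : ℝ) (p : ℍ[ℝ]) :
    quatEnd u (c • p) = c • quatEnd u p := by
  ext v
  simp [quatEnd_apply, smul_assoc]

theorem quatEnd_quatEnd (p q : ℍ[ℝ]) (w : V) :
    quatEnd u p (quatEnd u q w) = quatEnd u (p * q) w := by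
  rw [quatEnd_mul]
  rfl

theorem quatEnd_one (w : V) : quatEnd u 1 w = w := by
  simp [quatEnd_apply]

theorem quatEnd_neg (p : ℍ[ℝ]) (w : V) : quatEnd u (-p) w = -quatEnd u p w := by
  simp [quatEnd_apply]

theorem sp1Action_add [IsTopologicalAddGroup V] (p q : ℍ[ℝ]) (β : V [⋀^Fin k]→L[ℝ] ℂ) :
    sp1Action u (p + q) β = sp1Action u p β + sp1Action u q β := by
  simp only [sp1Action, quatEnd_add, formAction_add]

theorem sp1Action_smul [ContinuousSMul ℝ V] (c : ℝ) (p : ℍ[ℝ]) (β : V [⋀^Fin k]→L[ℝ] ℂ) :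
    sp1Action u (c • p) β = (c : ℂ) • sp1Action u p β := by
  simp only [sp1Action, quatEnd_smul, formAction_smul]
  ext v
  simp

theorem sp1Action_comm [IsTopologicalAddGroup V] (p q : ℍ[ℝ]) (β : V [⋀^Fin k]→L[ℝ] ℂ) :
    sp1Action u p (sp1Action u q β) - sp1Action u q (sp1Action u p β) =
      sp1Action u (p * q - q * p) β := by
  simp only [sp1Action, formAction_comm, quatEnd_sub, quatEnd_mul]

@[simp] theorem qi_re : qi.re = 0 := rfl
@[simp] theorem qi_imI : qi.imI = 1 := rfl
@[simp] theorem qi_imJ : qi.imJ = 0 := rfl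
@[simp] theorem qi_imK : qi.imK = 0 := rfl
@[simp] theorem qj_re : qj.re = 0 := rfl
@[simp] theorem qj_imI : qj.imI = 0 := rfl
@[simp] theorem qj_imJ : qj.imJ = 1 := rfl
@[simp] theorem qj_imK : qj.imK = 0 := rfl
@[simp] theorem qk_re : qk.re = 0 := rfl
@[simp] theorem qk_imI : qk.imI = 0 := rfl
@[simp] theorem qk_imJ : qk.imJ = 0 := rfl
@[simp] theorem qk_imK : qk.imK = 1 := rfl

theorem qi_mul_qi : qi * qi = -1 := by ext <;> simp
theorem qj_mul_qj : qj * qj = -1 := by ext <;> simp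
theorem qk_mul_qk : qk * qk = -1 := by ext <;> simp
theorem qi_mul_qj : qi * qj = qk := by ext <;> simp
theorem qj_mul_qi : qj * qi = -qk := by ext <;> simp
theorem qj_mul_qk : qj * qk = qi := by ext <;> simp
theorem qk_mul_qj : qk * qj = -qi := by ext <;> simp
theorem qk_mul_qi : qk * qi = qj := by ext <;> simp
theorem qi_mul_qk : qi * qk = -qj := by ext <;> simp

theorem eq_of_re_eq_zero {p : ℍ[ℝ]} (hp : p.re = 0) :
    p = p.imI • qi + p.imJ • qj + p.imK • qk := by
  ext <;> simp [hp]

theorem sp1Action_of_re_eq_zero [IsTopologicalAddGroup V] [ContinuousSMul ℝ V]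
    {p : ℍ[ℝ]} (hp : p.re = 0) (β : V [⋀^Fin k]→L[ℝ] ℂ) :
    sp1Action u p β = (p.imI : ℂ) • sp1Action u qi β + (p.imJ : ℂ) • sp1Action u qj β
      + (p.imK : ℂ) • sp1Action u qk β := by
  conv_lhs => rw [eq_of_re_eq_zero hp]
  simp only [sp1Action_add, sp1Action_smul]

theorem sp1Action_qi_qj [IsTopologicalAddGroup V] [ContinuousSMul ℝ V] (β : V [⋀^Fin k]→L[ℝ] ℂ) :
    sp1Action u qi (sp1Action u qj β) - sp1Action u qj (sp1Action u qi β) =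
      (2 : ℂ) • sp1Action u qk β := by
  rw [sp1Action_comm, qi_mul_qj, qj_mul_qi, sub_neg_eq_add, sp1Action_add]
  exact (two_smul ℂ _).symm

theorem sp1Action_qj_qk [IsTopologicalAddGroup V] [ContinuousSMul ℝ V] (β : V [⋀^Fin k]→L[ℝ] ℂ) :
    sp1Action u qj (sp1Action u qk β) - sp1Action u qk (sp1Action u qj β) =
      (2 : ℂ) • sp1Action u qi β := by
  rw [sp1Action_comm, qj_mul_qk, qk_mul_qj, sub_neg_eq_add, sp1Action_add]
  exact (two_smul ℂ _).symm

theorem sp1Action_qk_qi [IsTopologicalAddGroup V] [ContinuousSMul ℝ V] (β : V [⋀^Fin k]→L[ℝ] ℂ) :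
    sp1Action u qk (sp1Action u qi β) - sp1Action u qi (sp1Action u qk β) =
      (2 : ℂ) • sp1Action u qj β := by
  rw [sp1Action_comm, qk_mul_qi, qi_mul_qk, sub_neg_eq_add, sp1Action_add]
  exact (two_smul ℂ _).symm

theorem casimir_apply (β : V [⋀^Fin k]→L[ℝ] ℂ) :
    casimir u β = sp1Action u qi (sp1Action u qi β) + sp1Action u qj (sp1Action u qj β)
      + sp1Action u qk (sp1Action u qk β) := rfl

theorem sp1Action_compContinuousLinearMap (u' : HSpace n ≃L[ℝ] V') (L : V' →L[ℝ] V)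
    (h : ∀ v, L (u' v) = u v) (p : ℍ[ℝ]) (β : V [⋀^Fin k]→L[ℝ] ℂ) :
    sp1Action u' p (β.compContinuousLinearMap L) =
      (sp1Action u p β).compContinuousLinearMap L := by
  refine formAction_compContinuousLinearMap L _ _ (fun v => ?_) β
  rw [quatEnd_apply, quatEnd_apply, h]
  congr 2
  rw [ContinuousLinearEquiv.eq_symm_apply, ← h, ContinuousLinearEquiv.apply_symm_apply]

theorem casimir_compContinuousLinearMap (u' : HSpace n ≃L[ℝ] V') (L : V' →L[ℝ] V)
    (h : ∀ v, L (u' v) = u v) (β : V [⋀^Fin k]→L[ℝ] ℂ) :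
    casimir u' (β.compContinuousLinearMap L) = (casimir u β).compContinuousLinearMap L := by
  simp only [casimir_apply, sp1Action_compContinuousLinearMap u u' L h]
  rfl

/-- The Casimir operator commutes with the action of `𝔰𝔭(1)`. -/
theorem casimir_sp1Action [IsTopologicalAddGroup V] [ContinuousSMul ℝ V]
    {p : ℍ[ℝ]} (hp : p.re = 0) (β : V [⋀^Fin k]→L[ℝ] ℂ) :
    casimir u (sp1Action u p β) = sp1Action u p (casimir u β) := by
  -- By linearity it suffices to treat `qi`, `qj`, `qk`. The commutation relations, used as
  -- rewriting rules, put all products of the three operators in a common order.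
  have hij := fun β : V [⋀^Fin k]→L[ℝ] ℂ => eq_add_of_sub_eq (sp1Action_qi_qj u β)
  have hjk := fun β : V [⋀^Fin k]→L[ℝ] ℂ => eq_add_of_sub_eq (sp1Action_qj_qk u β)
  have hki := fun β : V [⋀^Fin k]→L[ℝ] ℂ => eq_add_of_sub_eq (sp1Action_qk_qi u β)
  simp only [sp1Action_of_re_eq_zero u hp, map_add, map_smul]
  congr 1
  · congr 1
    · congr 1
      simp only [casimir_apply, map_add, hij, map_smul, hki]
      module
    · congr 1
      simp only [casimir_apply, map_add, hij, map_smul, hjk]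
      module
  · congr 1
    simp only [casimir_apply, map_add, hjk, map_smul, hki]
    module

/-- The Casimir operator commutes with the action of endomorphisms that commute with the
quaternions. -/
theorem casimir_formAction [IsTopologicalAddGroup V] (A : V →L[ℝ] V)
    (hA : ∀ p v, A (quatEnd u p v) = quatEnd u p (A v)) (β : V [⋀^Fin k]→L[ℝ] ℂ) :
    casimir u (formAction A β) = formAction A (casimir u β) := by
  have h : ∀ p (β : V [⋀^Fin k]→L[ℝ] ℂ),
      sp1Action u p (formAction A β) = formAction A (sp1Action u p β) := by
    intro p β
    rw [← sub_eq_zero, sp1Action, formAction_comm]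
    have : quatEnd u p ∘L A - A ∘L quatEnd u p = 0 := by
      ext v; simp [hA]
    rw [this]
    ext v
    simp [formAction_apply]
  simp only [casimir_apply, h, map_add]

/-- The $\mathbb H$-linear factor of `g` commutes with left multiplication, and the unit factor $q$
replaces $p$ by $qp\bar q$. This rotates the imaginary quaternions, and $I^2+J^2+K^2$ is invariant
under rotations. -/
theorem casimir_trans [IsTopologicalAddGroup V] [ContinuousSMul ℝ V]
    (g : HSpace n ≃L[ℝ] HSpace n) (hg : IsSpGL g) :
    (casimir (g.trans u) : (V [⋀^Fin k]→L[ℝ] ℂ) →ₗ[ℂ] _) = casimir u := by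
  obtain ⟨q, hq, A, hA⟩ := hg
  have hq2 : q.re ^ 2 + q.imI ^ 2 + q.imJ ^ 2 + q.imK ^ 2 = 1 := by
    have := Quaternion.normSq_eq_norm_mul_self q
    rw [hq, Quaternion.normSq_def'] at this
    linarith
  have hq0 : q ≠ 0 := by rintro rfl; simp at hq
  have hqs : star q * q = 1 := by
    rw [Quaternion.star_mul_self, Quaternion.normSq_eq_norm_mul_self, hq]; simp
  have hend : ∀ p, quatEnd (g.trans u) p = quatEnd u (q * p * star q) := by
    intro p
    ext v
    simp only [quatEnd_apply, ContinuousLinearEquiv.trans_apply,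
      ContinuousLinearEquiv.symm_trans_apply]
    congr 1
    obtain ⟨w, hw⟩ : ∃ w, u.symm v = g w := ⟨g.symm (u.symm v), by simp⟩
    rw [hw, g.symm_apply_apply, hA, hA, map_smul, smul_smul, smul_smul, mul_assoc _ _ q, hqs,
      mul_one]
  have hact : ∀ p (β : V [⋀^Fin k]→L[ℝ] ℂ),
      sp1Action (g.trans u) p β = sp1Action u (q * p * star q) β := by
    intro p β
    rw [sp1Action, sp1Action, hend]
  have hij := fun β : V [⋀^Fin k]→L[ℝ] ℂ => eq_add_of_sub_eq (sp1Action_qi_qj u β)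
  have hjk := fun β : V [⋀^Fin k]→L[ℝ] ℂ => eq_add_of_sub_eq (sp1Action_qj_qk u β)
  have hki := fun β : V [⋀^Fin k]→L[ℝ] ℂ => eq_add_of_sub_eq (sp1Action_qk_qi u β)
  have hre : ∀ p : ℍ[ℝ], p.re = 0 → (q * p * star q).re = 0 := by
    intro p hp
    simp [hp]
    ring
  refine LinearMap.ext fun β => ?_
  simp only [casimir_apply, hact, sp1Action_of_re_eq_zero u (hre qi rfl),
    sp1Action_of_re_eq_zero u (hre qj rfl), sp1Action_of_re_eq_zero u (hre qk rfl), map_add,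
    map_smul, hij, hjk, hki]
  -- The entries of the rotation matrix are quadratic in $q$, so its columns have squared length
  -- $|q|^4$. Writing $1$ as $|q|^4$ turns the claim into a polynomial identity in the components of
  -- $q$.
  have hN : ((q.re : ℂ) ^ 2 + (q.imI : ℂ) ^ 2 + (q.imJ : ℂ) ^ 2 + (q.imK : ℂ) ^ 2) ^ 2 = 1 := by
    have := congrArg (fun t : ℝ => (t : ℂ) ^ 2) hq2
    simpa using this
  conv_rhs => rw [← one_smul ℂ (_ + _ + _), ← hN]
  simp
  module

end Sp1

/-! ### An inner product on forms for which the quaternion units act by skew operators. -/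

section InvariantInner

/-- An injection into a Hermitian space induces an inner product on the source; this is its
orthogonal complement. -/
theorem isCompl_comap_orthogonal {X F : Type*} [AddCommGroup X] [Module ℂ X]
    [NormedAddCommGroup F] [InnerProductSpace ℂ F] [FiniteDimensional ℂ F]
    (Φ : X →ₗ[ℂ] F) (hΦ : Function.Injective Φ) (S : Submodule ℂ X) :
    IsCompl S ((S.map Φ)ᗮ.comap Φ) := by
  constructor
  · rw [Submodule.disjoint_def]
    intro x hx hx'
    apply hΦ
    rw [map_zero]
    exact inner_self_eq_zero.1 ((Submodule.mem_orthogonal _ _).1 hx' _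
      (Submodule.mem_map_of_mem hx))
  · rw [codisjoint_iff_le_sup]
    intro x _
    obtain ⟨y, hy, z, hz, hyz⟩ := (S.map Φ).exists_add_mem_mem_orthogonal (Φ x)
    obtain ⟨s, hs, rfl⟩ := hy
    rw [Submodule.mem_sup]
    refine ⟨s, hs, x - s, ?_, by abel⟩
    rw [Submodule.mem_comap, map_sub, hyz, add_sub_cancel_left]
    exact hz

variable {V : Type*} [AddCommGroup V] [Module ℝ V] [TopologicalSpace V] {n k : ℕ}
  {ι : Type*}

/-- The values of a form on the tuples of members of a family of vectors. -/
def formValues (b : ι → V) :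
    (V [⋀^Fin k]→L[ℝ] ℂ) →ₗ[ℂ] EuclideanSpace ℂ (Fin k → ι) where
  toFun β := WithLp.toLp 2 fun f => β (b ∘ f)
  map_add' β γ := by ext f; simp
  map_smul' c β := by ext f; simp

theorem formValues_apply (b : ι → V) (β : V [⋀^Fin k]→L[ℝ] ℂ) (f : Fin k → ι) :
    formValues b β f = β (b ∘ f) := rfl

theorem formValues_injective (b : Module.Basis ι ℝ V) :
    Function.Injective (formValues (k := k) b) := by
  intro β γ h
  apply ContinuousAlternatingMap.toAlternatingMap_injective
  apply AlternatingMap.coe_multilinearMap_injective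
  refine Module.Basis.ext_multilinear (fun _ => b) fun f => ?_
  exact congrArg (fun x : EuclideanSpace ℂ (Fin k → ι) => x f) h

/-- An endomorphism permuting basis vectors by an involution `τ`, with signs reversed under `τ`, is
skew. For each slot `j`, replacing `f j` by `τ (f j)` is an involution on index tuples; reindexing
by it moves the action to the other factor with a minus sign. -/
theorem inner_formValues_formAction [Fintype ι] (b : ι → V) (A : V →L[ℝ] V) (τ : ι → ι) (ε : ι → ℝ)
    (hA : ∀ c, A (b c) = ε c • b (τ c)) (hτ : ∀ c, τ (τ c) = c) (hε : ∀ c, ε (τ c) = -ε c)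
    (β γ : V [⋀^Fin k]→L[ℝ] ℂ) :
    inner ℂ (formValues b (formAction A β)) (formValues b γ) =
      -inner ℂ (formValues b β) (formValues b (formAction A γ)) := by
  classical
  have hval : ∀ (β : V [⋀^Fin k]→L[ℝ] ℂ) f, formValues b (formAction A β) f =
      -∑ j, (ε (f j) : ℂ) * formValues b β (Function.update f j (τ (f j))) := by
    intro β f
    rw [formValues_apply, formAction_apply]
    congr 1
    refine Finset.sum_congr rfl fun j _ => ?_
    rw [Function.comp_apply, hA, ContinuousAlternatingMap.map_update_smul, formValues_apply,
      Function.comp_update]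
    simp
  simp only [PiLp.inner_apply, RCLike.inner_apply, hval, map_neg, map_sum, map_mul, neg_mul,
    mul_neg, Finset.sum_neg_distrib, Finset.mul_sum, Finset.sum_mul, Complex.conj_ofReal, neg_neg]
  rw [Finset.sum_comm, Finset.sum_comm (f := fun f j => _ * _ * _), ← Finset.sum_neg_distrib]
  refine Finset.sum_congr rfl fun j _ => ?_
  rw [← Finset.sum_neg_distrib]
  have hinv : Function.Involutive fun f : Fin k → ι => Function.update f j (τ (f j)) := by
    intro f
    simp [hτ]
  refine Fintype.sum_equiv hinv.toPerm _ _ fun f => ?_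
  have h2 := hinv f
  simp only [Function.Involutive.coe_toPerm] at h2 ⊢
  rw [h2]
  simp only [Function.update_self, hε]
  push_cast
  ring

/-- The units `1, i, j, k`. -/
def quatUnit : Fin 4 → ℍ[ℝ] := ![1, qi, qj, qk]

/-- The real basis `1, i, j, k` of the quaternions. -/
def quatBasis : Module.Basis (Fin 4) ℝ ℍ[ℝ] :=
  Module.Basis.ofEquivFun
    { toFun := fun q => ![q.re, q.imI, q.imJ, q.imK]
      invFun := fun f => ⟨f 0, f 1, f 2, f 3⟩
      left_inv := fun q => rfl
      right_inv := fun f => by ext c; fin_cases c <;> rfl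
      map_add' := fun p q => by simp
      map_smul' := fun c q => by simp }

theorem quatBasis_apply (c : Fin 4) : quatBasis c = quatUnit c := by
  apply quatBasis.repr.injective
  rw [Module.Basis.repr_self]
  ext d
  change Finsupp.single c (1 : ℝ) d =
    (![(quatUnit c).re, (quatUnit c).imI, (quatUnit c).imJ, (quatUnit c).imK] : Fin 4 → ℝ) d
  fin_cases c <;> fin_cases d <;> simp [quatUnit]

/-- The real basis of `V` given by a frame. -/
def frameBasis (u : HSpace n ≃L[ℝ] V) : Module.Basis ((_ : Fin n) × Fin 4) ℝ V :=
  (Pi.basis fun _ : Fin n => quatBasis).map u.toLinearEquiv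

theorem frameBasis_apply (u : HSpace n ≃L[ℝ] V) (c : (_ : Fin n) × Fin 4) :
    frameBasis u c = u (Pi.single c.1 (quatUnit c.2)) := by
  rw [frameBasis, Module.Basis.map_apply, Pi.basis_apply, quatBasis_apply]
  rfl

theorem inner_sp1Action_of_signedPerm (u : HSpace n ≃L[ℝ] V) (p : ℍ[ℝ]) (τ : Fin 4 → Fin 4)
    (ε : Fin 4 → ℝ) (hp : ∀ c, p * quatUnit c = ε c • quatUnit (τ c)) (hτ : ∀ c, τ (τ c) = c)
    (hε : ∀ c, ε (τ c) = -ε c) (β γ : V [⋀^Fin k]→L[ℝ] ℂ) :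
    inner ℂ (formValues (frameBasis u) (sp1Action u p β)) (formValues (frameBasis u) γ) =
      -inner ℂ (formValues (frameBasis u) β) (formValues (frameBasis u) (sp1Action u p γ)) := by
  refine inner_formValues_formAction _ _ (fun c => ⟨c.1, τ c.2⟩) (fun c => ε c.2) ?_
    (fun c => by simp [hτ]) (fun c => by simp [hε]) β γ
  intro c
  rw [frameBasis_apply, frameBasis_apply, quatEnd_apply, u.symm_apply_apply, ← map_smul]
  congr 1
  rw [← Pi.single_smul, ← Pi.single_smul, ← hp, smul_eq_mul]

theorem inner_sp1Action_unit (u : HSpace n ≃L[ℝ] V) (p : ℍ[ℝ]) (hp : p = qi ∨ p = qj ∨ p = qk)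
    (β γ : V [⋀^Fin k]→L[ℝ] ℂ) :
    inner ℂ (formValues (frameBasis u) (sp1Action u p β)) (formValues (frameBasis u) γ) =
      -inner ℂ (formValues (frameBasis u) β) (formValues (frameBasis u) (sp1Action u p γ)) := by
  rcases hp with rfl | rfl | rfl
  · refine inner_sp1Action_of_signedPerm u qi ![1, 0, 3, 2] ![1, -1, 1, -1] ?_ ?_ ?_ β γ <;>
      intro c <;> fin_cases c <;>
      simp [quatUnit, qi_mul_qi, qi_mul_qj, qi_mul_qk]
  · refine inner_sp1Action_of_signedPerm u qj ![2, 3, 0, 1] ![1, -1, -1, 1] ?_ ?_ ?_ β γ <;>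
      intro c <;> fin_cases c <;>
      simp [quatUnit, qj_mul_qi, qj_mul_qj, qj_mul_qk]
  · refine inner_sp1Action_of_signedPerm u qk ![3, 2, 1, 0] ![1, 1, -1, -1] ?_ ?_ ?_ β γ <;>
      intro c <;> fin_cases c <;>
      simp [quatUnit, qk_mul_qi, qk_mul_qj, qk_mul_qk]

theorem finiteDimensional_forms (u : HSpace n ≃L[ℝ] V) :
    FiniteDimensional ℂ (V [⋀^Fin k]→L[ℝ] ℂ) :=
  FiniteDimensional.of_injective _ (formValues_injective (frameBasis u))

end InvariantInner

/-! ### Subrepresentations and complete reducibility. -/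

section Subrep

variable {V : Type*} [AddCommGroup V] [Module ℝ V] [TopologicalSpace V]
  [IsTopologicalAddGroup V] [ContinuousSMul ℝ V] {n k : ℕ} (u : HSpace n ≃L[ℝ] V)

theorem isSubrep_iff {W : Submodule ℂ (V [⋀^Fin k]→L[ℝ] ℂ)} : IsSubrep u W ↔
    ∀ p, (p = qi ∨ p = qj ∨ p = qk) → ∀ w ∈ W, sp1Action u p w ∈ W := by
  constructor
  · rintro h p (rfl | rfl | rfl) w hw
    exacts [h _ rfl w hw, h _ rfl w hw, h _ rfl w hw]
  · intro h p hp w hw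
    rw [sp1Action_of_re_eq_zero u hp]
    exact W.add_mem (W.add_mem (W.smul_mem _ (h _ (by simp) w hw))
      (W.smul_mem _ (h _ (by simp) w hw))) (W.smul_mem _ (h _ (by simp) w hw))

omit [IsTopologicalAddGroup V] [ContinuousSMul ℝ V] in
theorem IsSubrep.inf {u : HSpace n ≃L[ℝ] V} {W W' : Submodule ℂ (V [⋀^Fin k]→L[ℝ] ℂ)}
    (h : IsSubrep u W) (h' : IsSubrep u W') : IsSubrep u (W ⊓ W') :=
  fun p hp w hw => ⟨h p hp w hw.1, h' p hp w hw.2⟩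

theorem isSubrep_eigenspace_casimir (c : ℂ) :
    IsSubrep u (Module.End.eigenspace (casimir u : (V [⋀^Fin k]→L[ℝ] ℂ) →ₗ[ℂ] _) c) := by
  intro p hp w hw
  rw [Module.End.mem_eigenspace_iff] at hw ⊢
  rw [casimir_sp1Action u hp, hw, map_smul]

theorem IsSubrep.exists_isCompl {u : HSpace n ≃L[ℝ] V} {W : Submodule ℂ (V [⋀^Fin k]→L[ℝ] ℂ)}
    (h : IsSubrep u W) : ∃ W', IsSubrep u W' ∧ IsCompl W W' := by
  refine ⟨_, ?_, isCompl_comap_orthogonal _ (formValues_injective (frameBasis u)) W⟩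
  rw [isSubrep_iff] at h ⊢
  intro p hp w hw
  rw [Submodule.mem_comap, Submodule.mem_orthogonal] at hw ⊢
  rintro _ ⟨x, hx, rfl⟩
  have := inner_sp1Action_unit u p hp x w
  rw [hw _ (Submodule.mem_map_of_mem (h p hp x hx)), eq_comm, neg_eq_zero] at this
  exact this

/-- Complete reducibility. -/
theorem IsSubrep.le_sSup_irred {u : HSpace n ≃L[ℝ] V} {W : Submodule ℂ (V [⋀^Fin k]→L[ℝ] ℂ)}
    (h : IsSubrep u W) : W ≤ sSup {S | IsIrredSubrep u S ∧ S ≤ W} := by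
  have := finiteDimensional_forms (k := k) u
  induction W using WellFoundedLT.induction with
  | ind W ih =>
  by_cases hW : W = ⊥
  · rw [hW]; exact bot_le
  -- A minimal nonzero subrepresentation of `W` is irreducible. By the modular law, an invariant
  -- complement cut down to `W` splits it off, leaving a strictly smaller subrepresentation for the
  -- induction.
  obtain ⟨S, ⟨hS, hS0, hSW⟩, hmin⟩ := WellFounded.has_min
    (wellFounded_lt (α := Submodule ℂ (V [⋀^Fin k]→L[ℝ] ℂ)))
    {S | IsSubrep u S ∧ S ≠ ⊥ ∧ S ≤ W} ⟨W, h, hW, le_rfl⟩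
  have hirr : IsIrredSubrep u S := by
    refine ⟨hS, hS0, fun S' hS' hS'u => ?_⟩
    by_contra! hcon
    exact hmin S' ⟨hS'u, hcon.1, hS'.trans hSW⟩ (lt_of_le_of_ne hS' hcon.2)
  obtain ⟨S', hS', hc⟩ := hS.exists_isCompl
  have hsup : S ⊔ S' ⊓ W = W := by
    rw [← sup_inf_assoc_of_le S' hSW, hc.sup_eq_top, top_inf_eq]
  have hlt : S' ⊓ W < W := by
    refine lt_of_le_of_ne inf_le_right fun heq => hS0 ?_
    rw [eq_bot_iff, ← hc.inf_eq_bot]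
    exact le_inf le_rfl (hSW.trans (inf_eq_right.1 heq))
  conv_lhs => rw [← hsup]
  refine sup_le (le_sSup ⟨hirr, hSW⟩) ((ih _ hlt (hS'.inf h)).trans (sSup_le_sSup ?_))
  exact fun T hT => ⟨hT.1, hT.2.trans inf_le_right⟩

end Subrep

/-! ### Highest weight vectors for operators with the relations of imaginary quaternions. -/

section AbstractHighestWeight

attribute [local instance] LieRing.ofAssociativeRing

variable {X : Type*} [AddCommGroup X] [Module ℂ X] {I J K : X →ₗ[ℂ] X}

/-- A highest weight is a natural number. -/
theorem eigenvalue_nat_of_highest [FiniteDimensional ℂ X]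
    (hIJ : ∀ x, I (J x) - J (I x) = (2 : ℂ) • K x)
    (hJK : ∀ x, J (K x) - K (J x) = (2 : ℂ) • I x)
    (hKI : ∀ x, K (I x) - I (K x) = (2 : ℂ) • J x) {w : X} (hw : w ≠ 0) {μ : ℂ}
    (hI : I w = μ • w) (hJ : J w = Complex.I • K w) :
    ∃ m : ℕ, μ = m * Complex.I := by
  have hii : Complex.I * Complex.I = -1 := Complex.I_mul_I
  -- The factor $-\sqrt{-1}$ turns the eigenvalue $m\sqrt{-1}$ of `I` into the weight $m$; the
  -- factor $-1/4$ in `f` normalises $[e,f]=h$. The condition `hJ` on `w` says $e\,w=0$.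
  let h : Module.End ℂ X := (-Complex.I) • I
  let e : Module.End ℂ X := J - Complex.I • K
  let f : Module.End ℂ X := (-1 / 4 : ℂ) • (J + Complex.I • K)
  -- An `IsSl2Triple` requires `h` to be nonzero; if `h = 0`, the eigenvalue is zero.
  by_cases h0 : h = 0
  · refine ⟨0, ?_⟩
    have h1 : h w = 0 := by rw [h0]; rfl
    have h2 : (-Complex.I * μ) • w = 0 := by rw [mul_smul, ← hI]; exact h1
    simpa [hw] using h2
  have ht : IsSl2Triple h e f := by
    refine ⟨h0, ?_, ?_, ?_⟩ <;> refine LinearMap.ext fun x => ?_ <;>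
      simp only [LieRing.of_associative_ring_bracket, Module.End.mul_apply, LinearMap.sub_apply,
        LinearMap.smul_apply, LinearMap.add_apply, LinearMap.neg_apply, map_sub, map_add, map_smul,
        h, e, f, two_smul]
    · linear_combination (norm := match_scalars <;> ring_nf) (-(1 / 2) * Complex.I) • hJK x
    · linear_combination (norm := match_scalars <;> ring_nf <;> norm_num)
        (-Complex.I) • hIJ x + hKI x
    · linear_combination (norm := match_scalars <;> ring_nf <;> norm_num)
        (Complex.I / 4) • hIJ x + (1 / 4 : ℂ) • hKI x
  have hP : ht.HasPrimitiveVectorWith w (-Complex.I * μ) :=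
    ⟨hw, by simp [h, hI, smul_smul], by simp [e, hJ]⟩
  obtain ⟨m, hm⟩ := hP.exists_nat
  exact ⟨m, by rw [← hm]; linear_combination μ * hii⟩

/-- Commuting $J$ past $K$ gives $J^2w=\sqrt{-1}\,JKw=-K^2w-2mw$. The $K^2$ terms cancel, and
$I^2w=-m^2w$ supplies the rest. -/
theorem casimir_of_highest (hJK : ∀ x, J (K x) - K (J x) = (2 : ℂ) • I x) {w : X} {m : ℂ}
    (hI : I w = (m * Complex.I) • w) (hJ : J w = Complex.I • K w) :
    I (I w) + J (J w) + K (K w) = (-(m * (m + 2))) • w := by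
  have hii : Complex.I * Complex.I = -1 := Complex.I_mul_I
  rw [hJ, hI, map_smul, map_smul, hI, eq_add_of_sub_eq (hJK w), hJ, map_smul, hI]
  match_scalars
  · linear_combination (m ^ 2 + 2 * m) * hii
  · linear_combination hii

/-- An eigenvector of `I` in `W` whose eigenvalue has largest imaginary part is a highest weight
vector. Imaginary parts are compared because eigenvalues are not yet known to be integer multiples
of $\sqrt{-1}$. -/
theorem exists_highest [FiniteDimensional ℂ X]
    (hIJ : ∀ x, I (J x) - J (I x) = (2 : ℂ) • K x)
    (hJK : ∀ x, J (K x) - K (J x) = (2 : ℂ) • I x)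
    (hKI : ∀ x, K (I x) - I (K x) = (2 : ℂ) • J x) {W : Submodule ℂ X} (hW : W ≠ ⊥)
    (hWI : ∀ w ∈ W, I w ∈ W) (hWJ : ∀ w ∈ W, J w ∈ W) (hWK : ∀ w ∈ W, K w ∈ W) :
    ∃ m : ℕ, IsGreatest {m : ℤ | ∃ w ∈ W, w ≠ 0 ∧ I w = ((m : ℂ) * Complex.I) • w} m ∧
      ∃ w ∈ W, w ≠ 0 ∧ I (I w) + J (J w) + K (K w) = (-(m * (m + 2)) : ℂ) • w := by
  have : Nontrivial W := Submodule.nontrivial_iff_ne_bot.2 hW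
  let g : Module.End ℂ W := I.restrict hWI
  have hg : ∀ (μ : ℂ) (w : X), w ∈ W → w ≠ 0 → I w = μ • w → g.HasEigenvalue μ := by
    intro μ w hw hw0 hμ
    refine Module.End.hasEigenvalue_of_hasEigenvector (x := ⟨w, hw⟩)
      ⟨Module.End.mem_eigenspace_iff.2 (Subtype.ext hμ), ?_⟩
    simpa [Subtype.ext_iff] using hw0
  obtain ⟨μ, hμ, hmax⟩ := Set.exists_max_image {μ | g.HasEigenvalue μ} Complex.im
    (Module.End.finite_hasEigenvalue g) (Module.End.exists_eigenvalue g)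
  obtain ⟨⟨w, hw⟩, hwμ, hw0⟩ := hμ.exists_hasEigenvector
  have hw0 : w ≠ 0 := by simpa [Subtype.ext_iff] using hw0
  have hI : I w = μ • w := congrArg Subtype.val (Module.End.mem_eigenspace_iff.1 hwμ)
  have hJ : J w = Complex.I • K w := by
    rw [← sub_eq_zero]
    by_contra hne
    -- The raising operator $J-\sqrt{-1}K$ adds $2\sqrt{-1}$ to the eigenvalue, contradicting
    -- maximality unless it kills `w`.
    have := hmax (μ + 2 * Complex.I) (hg _ _ (W.sub_mem (hWJ w hw)
      (W.smul_mem _ (hWK w hw))) hne ?_)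
    · norm_num at this
    · have h1 : J (I w) = μ • J w := by rw [hI, map_smul]
      have h2 : K (I w) = μ • K w := by rw [hI, map_smul]
      have hii : Complex.I * Complex.I = -1 := Complex.I_mul_I
      have h3 := hIJ w
      have h4 := hKI w
      rw [h1] at h3
      rw [h2] at h4
      rw [map_sub, map_smul, eq_add_of_sub_eq h3, ← sub_sub_self (μ • K w) (I (K w)), h4]
      match_scalars
      · linear_combination 2 * hii
      · ring
  obtain ⟨m, rfl⟩ := eigenvalue_nat_of_highest hIJ hJK hKI hw0 hI hJ
  refine ⟨m, ⟨⟨w, hw, hw0, by simpa using hI⟩, ?_⟩, w, hw, hw0, casimir_of_highest hJK hI hJ⟩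
  rintro m' ⟨w', hw', hw0', hI'⟩
  have := hmax _ (hg _ _ hw' hw0' hI')
  simp only [Complex.mul_I_im, Complex.intCast_re, Complex.natCast_re] at this
  exact_mod_cast this

end AbstractHighestWeight

/-! ### Isotypic components as Casimir eigenspaces. -/

section HighestWeight

variable {V : Type*} [AddCommGroup V] [Module ℝ V] [TopologicalSpace V]
  [IsTopologicalAddGroup V] [ContinuousSMul ℝ V] {n k : ℕ} (u : HSpace n ≃L[ℝ] V)

theorem IsSubrep.exists_highest {u : HSpace n ≃L[ℝ] V} {W : Submodule ℂ (V [⋀^Fin k]→L[ℝ] ℂ)}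
    (h : IsSubrep u W) (hW : W ≠ ⊥) : ∃ m : ℕ, IsGreatest (weights u W) m ∧
      ∃ w ∈ W, w ≠ 0 ∧ casimir u w = (-(m * (m + 2)) : ℂ) • w := by
  have := finiteDimensional_forms (k := k) u
  exact QuaternionicForms.exists_highest (sp1Action_qi_qj u) (sp1Action_qj_qk u)
    (sp1Action_qk_qi u) hW (h qi rfl) (h qj rfl) (h qk rfl)

/-- The eigenvalue of the Casimir operator on the irreducible representation with highest
weight `r`. -/
def casimirValue (r : ℤ) : ℂ := -((r : ℂ) * (r + 2))

/-- The value $-r(r+2)$ is unchanged by $r\mapsto-2-r$, so signs matter here: among nonnegative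
integers there is no coincidence. -/
theorem casimirValue_injOn {r s : ℤ} (hr : 0 ≤ r) (hs : 0 ≤ s)
    (h : casimirValue r = casimirValue s) : r = s := by
  have h1 : r * (r + 2) = s * (s + 2) := by
    have : (r : ℂ) * (r + 2) = s * (s + 2) := neg_injective h
    exact_mod_cast this
  nlinarith

/-- As in Schur's lemma, the intersection of `W` with the eigenspace is a subrepresentation; it
contains a highest weight vector, so it is all of `W`. -/
theorem IsIrredSubrep.le_eigenspace {u : HSpace n ≃L[ℝ] V}
    {W : Submodule ℂ (V [⋀^Fin k]→L[ℝ] ℂ)} (h : IsIrredSubrep u W) {r : ℤ}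
    (hr : IsGreatest (weights u W) r) :
    0 ≤ r ∧ W ≤ Module.End.eigenspace (casimir u) (casimirValue r) := by
  obtain ⟨m, hm, w, hw, hw0, hc⟩ := h.1.exists_highest h.2.1
  obtain rfl := hr.unique hm
  refine ⟨by positivity, ?_⟩
  rcases h.2.2 _ inf_le_left (h.1.inf (isSubrep_eigenspace_casimir u (casimirValue m))) with h' | h'
  · refine absurd ?_ hw0
    rw [← Submodule.mem_bot ℂ, ← h']
    exact ⟨hw, Module.End.mem_eigenspace_iff.2 (by rw [hc, casimirValue, Int.cast_natCast])⟩
  · exact inf_eq_left.1 h'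

/-- For the nontrivial inclusion, the eigenspace is a sum of irreducibles, and the Casimir value of
each one determines its highest weight. -/
theorem isotypic_of_nonneg {r : ℤ} (hr : 0 ≤ r) :
    isotypic k r u = Module.End.eigenspace (casimir u) (casimirValue r) := by
  apply le_antisymm
  · exact sSup_le fun W hW => (hW.1.le_eigenspace hW.2).2
  · refine (isSubrep_eigenspace_casimir u _).le_sSup_irred.trans (sSup_le_sSup ?_)
    rintro W ⟨hW, hle⟩
    refine ⟨hW, ?_⟩
    obtain ⟨m, hm, w, hw, hw0, hc⟩ := hW.1.exists_highest hW.2.1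
    have h1 : casimir u w = casimirValue r • w := Module.End.mem_eigenspace_iff.1 (hle hw)
    have h2 : casimirValue r = casimirValue m := by
      apply smul_left_injective ℂ hw0
      simp only
      rw [← h1, hc, casimirValue, Int.cast_natCast]
    rwa [casimirValue_injOn hr (by positivity) h2]

theorem isotypic_of_neg {r : ℤ} (hr : r < 0) : isotypic k r u = ⊥ := by
  rw [isotypic, sSup_eq_bot]
  intro W hW
  exact absurd (hW.1.le_eigenspace hW.2).1 (not_le.2 hr)

theorem isotypic_le_eigenspace (r : ℤ) :
    isotypic k r u ≤ Module.End.eigenspace (casimir u) (casimirValue r) :=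
  sSup_le fun _ hW => (hW.1.le_eigenspace hW.2).2

theorem iSup_isotypic : ⨆ r : ℤ, isotypic k r u = ⊤ := by
  rw [eq_top_iff]
  have htop : IsSubrep u (⊤ : Submodule ℂ (V [⋀^Fin k]→L[ℝ] ℂ)) := fun _ _ _ _ => trivial
  refine htop.le_sSup_irred.trans (sSup_le ?_)
  rintro W ⟨hW, -⟩
  obtain ⟨m, hm, -⟩ := hW.1.exists_highest hW.2.1
  have hle : W ≤ isotypic k m u := le_sSup ⟨hW, hm⟩
  exact hle.trans (le_iSup (fun r : ℤ => isotypic k r u) m)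

theorem isCompl_isotypic (r : ℤ) :
    IsCompl (isotypic k r u) (⨆ s : {s : ℤ // s ≠ r}, isotypic k s u) := by
  constructor
  · rcases lt_or_ge r 0 with hr | hr
    · rw [isotypic_of_neg u hr]
      exact disjoint_bot_left
    · rw [isotypic_of_nonneg u hr]
      refine (Module.End.eigenspaces_iSupIndep (casimir u) (casimirValue r)).mono_right ?_
      refine iSup_le fun s => ?_
      rcases lt_or_ge s.1 0 with hs | hs
      · rw [isotypic_of_neg u hs]
        exact bot_le
      · exact (isotypic_le_eigenspace u s).trans (le_iSup₂_of_le (casimirValue s)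
          (fun h => s.2 (casimirValue_injOn hs hr h)) le_rfl)
  · rw [codisjoint_iff_le_sup, ← iSup_isotypic u]
    refine iSup_le fun s => ?_
    by_cases h : s = r
    · subst h; exact le_sup_left
    · exact le_sup_of_le_right (le_iSup_of_le (⟨s, h⟩ : {s : ℤ // s ≠ r}) le_rfl)

/-- The number $1$ is the formal Casimir value at $r=-1$, needed for $\overline{\mathcal D}$ when
$r=0$. Actual eigenvalues are $-m(m+2)\le0$ with $m\ge0$, so it never occurs. -/
theorem eigenspace_casimir_one :
    Module.End.eigenspace (casimir u : (V [⋀^Fin k]→L[ℝ] ℂ) →ₗ[ℂ] _) 1 = ⊥ := by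
  have h := Module.End.eigenspaces_iSupIndep
    (casimir u : (V [⋀^Fin k]→L[ℝ] ℂ) →ₗ[ℂ] _) 1
  rw [← disjoint_top, ← iSup_isotypic u]
  refine h.mono_right (iSup_le fun r => ?_)
  rcases lt_or_ge r 0 with hr | hr
  · rw [isotypic_of_neg u hr]
    exact bot_le
  · refine (isotypic_le_eigenspace u r).trans (le_iSup₂_of_le (casimirValue r) ?_ le_rfl)
    intro h1
    have : -(r * (r + 2)) = 1 := by
      rw [casimirValue] at h1
      exact_mod_cast h1
    nlinarith

end HighestWeight

/-! ### The bundles $E_{k,r}$ and their projections. -/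

namespace SpGLStructure

variable {n k : ℕ} {M : Type*} [TopologicalSpace M]
  [ChartedSpace (EuclideanSpace ℝ (Fin (4 * n))) M] [IsManifold (𝓡 (4 * n)) ∞ M]
  (Q : SpGLStructure n M)

theorem isotypic_eq {x : M} {u u' : HSpace n ≃L[ℝ] TangentSpace (𝓡 (4 * n)) x}
    (hu : u ∈ Q.frames x) (hu' : u' ∈ Q.frames x) (r : ℤ) :
    isotypic k r u = isotypic k r u' := by
  obtain ⟨g, hg, rfl⟩ := (Q.mem_frames_iff x u hu u').1 hu'
  rcases lt_or_ge r 0 with hr | hr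
  · rw [isotypic_of_neg u hr, isotypic_of_neg _ hr]
  · rw [isotypic_of_nonneg u hr, isotypic_of_nonneg _ hr, casimir_trans u g hg]

theorem E_eq {x : M} {u : HSpace n ≃L[ℝ] TangentSpace (𝓡 (4 * n)) x}
    (hu : u ∈ Q.frames x) (r : ℤ) : Q.E k r x = isotypic k r u :=
  le_antisymm (iInf₂_le u hu) (le_iInf₂ fun _ hu' => (Q.isotypic_eq hu hu' r).le)

theorem frames_nonempty (x : M) : (Q.frames x).Nonempty := by
  obtain ⟨U, -, hxU, s, hs, -⟩ := Q.exists_section x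
  exact ⟨s x, hs x hxU⟩

theorem splits (r : ℤ) (x : M) : Q.Splits k r x := by
  obtain ⟨u, hu⟩ := Q.frames_nonempty x
  simp only [Splits, Q.E_eq hu]
  exact isCompl_isotypic u r

theorem proj_add_of_mem {x : M} {r s : ℤ} (hrs : r ≠ s) {β γ : Covector n k x}
    (hβ : β ∈ Q.E k r x) (hγ : γ ∈ Q.E k s x) : Q.proj k r x (β + γ) = β := by
  rw [proj, dif_pos (Q.splits r x), map_add]
  have h1 := Submodule.projection_apply_left (Q.splits (k := k) r x) ⟨β, hβ⟩
  have h2 : γ ∈ ⨆ s : {s : ℤ // s ≠ r}, Q.E k s x :=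
    Submodule.mem_iSup_of_mem (p := fun s : {s : ℤ // s ≠ r} => Q.E k s x) ⟨s, hrs.symm⟩ hγ
  have h3 := Submodule.projection_apply_right (Q.splits (k := k) r x) ⟨γ, h2⟩
  simp only at h1 h3
  rw [h1, h3, add_zero]

end SpGLStructure

/-! ### The quadratic Casimir relation on alternations of elements of $T^*\otimes E_{k,r}$. -/

section TensorProduct

open ContinuousAlternatingMap (alternatizeUncurryFin alternatizeUncurryFin_add
  alternatizeUncurryFin_smul alternatizeUncurryFinCLM_apply)

variable {E : Type*} [NormedAddCommGroup E] [NormedSpace ℝ E] [FiniteDimensional ℝ E] {n k : ℕ}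
  (u : HSpace n ≃L[ℝ] E)

/-- The action of `𝔰𝔭(1)` on covectors with values in the `k`-forms. -/
def homAction (p : ℍ[ℝ]) (ψ : E →L[ℝ] E [⋀^Fin k]→L[ℝ] ℂ) : E →L[ℝ] E [⋀^Fin k]→L[ℝ] ℂ :=
  LinearMap.toContinuousLinearMap (((sp1Action u p).restrictScalars ℝ) ∘ₗ ψ.toLinearMap) -
    ψ ∘L quatEnd u p

theorem homAction_apply (p : ℍ[ℝ]) (ψ : E →L[ℝ] E [⋀^Fin k]→L[ℝ] ℂ) (w : E) :
    homAction u p ψ w = sp1Action u p (ψ w) - ψ (quatEnd u p w) := rfl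

theorem sp1Action_alternatizeUncurryFin (p : ℍ[ℝ]) (ψ : E →L[ℝ] E [⋀^Fin k]→L[ℝ] ℂ) :
    sp1Action u p (alternatizeUncurryFin ψ) = alternatizeUncurryFin (homAction u p ψ) :=
  formAction_alternatizeUncurryFin _ _ _ fun _ => rfl

/-- The mixed term `∑ₐ Aₐ ⊗ Aₐ` of the Casimir operator of a tensor product. -/
def mixedCasimir (ψ : E →L[ℝ] E [⋀^Fin k]→L[ℝ] ℂ) : E →L[ℝ] E [⋀^Fin k]→L[ℝ] ℂ :=
  LinearMap.toContinuousLinearMap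
    (((sp1Action u qi).restrictScalars ℝ) ∘ₗ (ψ ∘L quatEnd u qi).toLinearMap +
     ((sp1Action u qj).restrictScalars ℝ) ∘ₗ (ψ ∘L quatEnd u qj).toLinearMap +
     ((sp1Action u qk).restrictScalars ℝ) ∘ₗ (ψ ∘L quatEnd u qk).toLinearMap)

theorem mixedCasimir_apply (ψ : E →L[ℝ] E [⋀^Fin k]→L[ℝ] ℂ) (w : E) :
    mixedCasimir u ψ w = sp1Action u qi (ψ (quatEnd u qi w)) +
      sp1Action u qj (ψ (quatEnd u qj w)) + sp1Action u qk (ψ (quatEnd u qk w)) := rfl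

theorem casimir_mixedCasimir {c : ℂ} {ψ : E →L[ℝ] E [⋀^Fin k]→L[ℝ] ℂ}
    (hψ : ∀ w, casimir u (ψ w) = c • ψ w) (w : E) :
    casimir u (mixedCasimir u ψ w) = c • mixedCasimir u ψ w := by
  have hi : casimir u (sp1Action u qi (ψ (quatEnd u qi w))) = _ := casimir_sp1Action u rfl _
  have hj : casimir u (sp1Action u qj (ψ (quatEnd u qj w))) = _ := casimir_sp1Action u rfl _
  have hk : casimir u (sp1Action u qk (ψ (quatEnd u qk w))) = _ := casimir_sp1Action u rfl _
  rw [mixedCasimir_apply, map_add, map_add, hi, hj, hk, hψ, hψ, hψ, map_smul, map_smul, map_smul,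
    smul_add, smul_add]

/-- The square is $\sum_{a,b}A_aA_b\,\psi(q_bq_a\,\cdot)$. Diagonal terms give $-C\psi$ since
$q_a^2=-1$; off-diagonal terms pair into commutators and give $-2$ times the mixed term. -/
theorem mixedCasimir_mixedCasimir {c : ℂ} {ψ : E →L[ℝ] E [⋀^Fin k]→L[ℝ] ℂ}
    (hψ : ∀ w, casimir u (ψ w) = c • ψ w) :
    mixedCasimir u (mixedCasimir u ψ) = (-c) • ψ + (-2 : ℂ) • mixedCasimir u ψ := by
  ext1 w
  have hij := fun β : E [⋀^Fin k]→L[ℝ] ℂ => eq_add_of_sub_eq (sp1Action_qi_qj u β)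
  have hjk := fun β : E [⋀^Fin k]→L[ℝ] ℂ => eq_add_of_sub_eq (sp1Action_qj_qk u β)
  have hki := fun β : E [⋀^Fin k]→L[ℝ] ℂ => eq_add_of_sub_eq (sp1Action_qk_qi u β)
  rw [add_apply, smul_apply, smul_apply, neg_smul, ← hψ, casimir_apply]
  simp only [mixedCasimir_apply, quatEnd_quatEnd, qi_mul_qi, qi_mul_qj, qi_mul_qk, qj_mul_qi,
    qj_mul_qj, qj_mul_qk, qk_mul_qi, qk_mul_qj, qk_mul_qk, quatEnd_neg, quatEnd_one, map_neg,
    map_add, hij, hjk, hki]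
  module

theorem homAction_homAction_unit {p : ℍ[ℝ]} (hp : p * p = -1)
    (ψ : E →L[ℝ] E [⋀^Fin k]→L[ℝ] ℂ) (w : E) :
    homAction u p (homAction u p ψ) w = sp1Action u p (sp1Action u p (ψ w)) -
      (2 : ℂ) • sp1Action u p (ψ (quatEnd u p w)) - ψ w := by
  simp only [homAction_apply, quatEnd_quatEnd, hp, quatEnd_neg, quatEnd_one, map_neg, map_sub]
  module

/-- The Casimir operator of a tensor product is the sum of those of the factors and twice the mixed
term. On covectors it is $-3$, as each unit squares to $-1$; the mixed term has sign $-2$ because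
the dual action on covectors carries a minus sign that `mixedCasimir` omits. -/
theorem casimir_alternatizeUncurryFin {c : ℂ} {ψ : E →L[ℝ] E [⋀^Fin k]→L[ℝ] ℂ}
    (hψ : ∀ w, casimir u (ψ w) = c • ψ w) :
    casimir u (alternatizeUncurryFin ψ) = (c - 3) • alternatizeUncurryFin ψ -
      (2 : ℂ) • alternatizeUncurryFin (mixedCasimir u ψ) := by
  rw [casimir_apply]
  simp only [sp1Action_alternatizeUncurryFin]
  rw [← alternatizeUncurryFin_add, ← alternatizeUncurryFin_add, ← alternatizeUncurryFin_smul,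
    ← alternatizeUncurryFin_smul, ← alternatizeUncurryFinCLM_apply (𝕜 := ℝ),
    ← alternatizeUncurryFinCLM_apply (𝕜 := ℝ), ← alternatizeUncurryFinCLM_apply (𝕜 := ℝ), ← map_sub]
  congr 1
  ext1 w
  have h := hψ w
  rw [casimir_apply] at h
  simp only [add_apply, sub_apply, smul_apply, sub_smul, ← h, mixedCasimir_apply,
    homAction_homAction_unit u qi_mul_qi, homAction_homAction_unit u qj_mul_qj,
    homAction_homAction_unit u qk_mul_qk]
  module

/-- The alternation of a covector with values in forms of weight `r` has components of weights
`r + 1` and `r - 1` only. -/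
theorem casimir_casimir_alternatizeUncurryFin {r : ℤ} {ψ : E →L[ℝ] E [⋀^Fin k]→L[ℝ] ℂ}
    (hψ : ∀ w, casimir u (ψ w) = casimirValue r • ψ w) :
    casimir u (casimir u (alternatizeUncurryFin ψ)) =
      (casimirValue (r + 1) + casimirValue (r - 1)) • casimir u (alternatizeUncurryFin ψ) -
        (casimirValue (r + 1) * casimirValue (r - 1)) • alternatizeUncurryFin ψ := by
  have h1 := casimir_alternatizeUncurryFin u hψ
  -- The mixed term preserves the eigenspace of the values, so the same formula applies to it. With
  -- its quadratic relation, the alternation of the mixed term can be eliminated.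
  have h2 := casimir_alternatizeUncurryFin u (casimir_mixedCasimir u hψ)
  rw [mixedCasimir_mixedCasimir u hψ, alternatizeUncurryFin_add, alternatizeUncurryFin_smul,
    alternatizeUncurryFin_smul] at h2
  rw [h1, map_sub, map_smul, map_smul, h1, h2]
  simp only [casimirValue]
  push_cast
  module

end TensorProduct

/-! ### Covariant differentiation in a chart, and the exterior derivative. -/

section Calculus

open ContinuousAlternatingMap (alternatizeUncurryFin alternatizeUncurryFinCLM
  alternatizeUncurryFinCLM_apply)

variable {E : Type*} [NormedAddCommGroup E] [NormedSpace ℝ E] {n k : ℕ}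

/-- The subalgebra `𝔰𝔭(1) + 𝔤𝔩(n,ℍ)` preserves the eigenspaces of the Casimir operator. -/
theorem casimir_formAction_of_isSpGLAlgebra (u : HSpace n ≃L[ℝ] E) (D : E →L[ℝ] E)
    (hD : IsSpGLAlgebra fun v => u.symm (D (u v))) (β : E [⋀^Fin k]→L[ℝ] ℂ) :
    casimir u (formAction D β) = formAction D (casimir u β) := by
  obtain ⟨p, hp, A, hA⟩ := hD
  -- After removal of the $\mathfrak{sp}(1)$ part, what is left is the transported $\mathbb
  -- H$-linear map, which commutes with the quaternions.
  have hA' : ∀ q v, (D - quatEnd u p) (quatEnd u q v) = quatEnd u q ((D - quatEnd u p) v) := by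
    intro q v
    have h : ∀ v, (D - quatEnd u p) v = u (A (u.symm v)) := by
      intro v
      have := hA (u.symm v)
      simp only [u.apply_symm_apply] at this
      rw [sub_apply, quatEnd_apply, sub_eq_iff_eq_add, ← map_add, add_comm, ← this,
        u.apply_symm_apply]
    rw [h, h, quatEnd_apply, quatEnd_apply, u.symm_apply_apply, u.symm_apply_apply, map_smul]
  have hsplit : ∀ β : E [⋀^Fin k]→L[ℝ] ℂ,
      formAction D β = sp1Action u p β + formAction (D - quatEnd u p) β := by
    intro β
    rw [sp1Action, ← formAction_add, add_sub_cancel]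
  rw [hsplit, map_add, casimir_sp1Action u hp, casimir_formAction u _ hA', hsplit]

theorem fderivCompContinuousLinearMap_comp_symm (u : HSpace n ≃L[ℝ] E) (S : HSpace n →L[ℝ] E)
    (β : E [⋀^Fin k]→L[ℝ] ℂ) :
    (β.fderivCompContinuousLinearMap (u : HSpace n →L[ℝ] E) S).compContinuousLinearMap
      (u.symm : E →L[ℝ] HSpace n) = -formAction (S ∘L (u.symm : E →L[ℝ] HSpace n)) β := by
  ext v
  rw [ContinuousAlternatingMap.compContinuousLinearMap_apply,
    ContinuousAlternatingMap.fderivCompContinuousLinearMap_apply,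
    ContinuousAlternatingMap.neg_apply, formAction_apply, neg_neg]
  refine Finset.sum_congr rfl fun j _ => ?_
  congr 1
  funext i
  by_cases h : i = j
  · subst h; simp
  · simp [h]

theorem fderivCompContinuousLinearMap_id (Γ : E →L[ℝ] E) (β : E [⋀^Fin k]→L[ℝ] ℂ) :
    β.fderivCompContinuousLinearMap (ContinuousLinearMap.id ℝ E) Γ = -formAction Γ β := by
  ext v
  rw [ContinuousAlternatingMap.fderivCompContinuousLinearMap_apply,
    ContinuousAlternatingMap.neg_apply, formAction_apply, neg_neg]
  refine Finset.sum_congr rfl fun j _ => ?_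
  congr 1
  funext i
  by_cases h : i = j
  · subst h; simp
  · simp [h]

theorem map_fderiv_eq_of_eventually {F G : Type*} [NormedAddCommGroup F] [NormedSpace ℝ F]
    [NormedAddCommGroup G] [NormedSpace ℝ G] [FiniteDimensional ℝ F]
    (L L' : F →ₗ[ℝ] G) {γ : E → F} {γ' : E →L[ℝ] F}
    {y : E} (hγ : HasFDerivAt γ γ' y) (h : ∀ᶠ z in 𝓝 y, L (γ z) = L' (γ z)) (w : E) :
    L (γ' w) = L' (γ' w) := by
  have h1 := (LinearMap.toContinuousLinearMap L).hasFDerivAt.comp y hγ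
  have h2 := (LinearMap.toContinuousLinearMap L').hasFDerivAt.comp y hγ
  exact congrArg (fun T : E →L[ℝ] G => T w) (h1.unique (h2.congr_of_eventuallyEq h))

/-- If a form has its values in an eigenspace of the Casimir operator, as computed in a moving
frame, then its exterior derivative at a point is the alternation of the covariant derivative, in
the same eigenspace, for every torsion-free connection that preserves the structure. -/
theorem exists_extDeriv_eq_alternatizeUncurryFin {β : E → E [⋀^Fin k]→L[ℝ] ℂ}
    {s : E → HSpace n →L[ℝ] E} {y : E} (u : HSpace n ≃L[ℝ] E) (hu : s y = u)
    (hβ : DifferentiableAt ℝ β y) (hs : DifferentiableAt ℝ s y) {c : ℂ}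
    (hc : ∀ᶠ z in 𝓝 y, casimir (ContinuousLinearEquiv.refl ℝ (HSpace n))
      ((β z).compContinuousLinearMap (s z)) = c • (β z).compContinuousLinearMap (s z))
    (Γ : E →L[ℝ] E →L[ℝ] E) (hΓ : ∀ v w, Γ v w = Γ w v)
    (hB : ∀ w, IsSpGLAlgebra fun v => u.symm (fderiv ℝ s y w v + Γ w (u v))) :
    ∃ ψ : E →L[ℝ] E [⋀^Fin k]→L[ℝ] ℂ, (∀ w, casimir u (ψ w) = c • ψ w) ∧
      extDeriv β y = alternatizeUncurryFin ψ := by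
  have hfin : FiniteDimensional ℝ (HSpace n [⋀^Fin k]→L[ℝ] ℂ) :=
    have := finiteDimensional_forms (k := k) (ContinuousLinearEquiv.refl ℝ (HSpace n))
    FiniteDimensional.complexToReal _
  let e := ContinuousLinearEquiv.refl ℝ (HSpace n)
  have hγ := hβ.hasFDerivAt.continuousAlternatingMapCompContinuousLinearMap hs.hasFDerivAt
  -- This is the covariant derivative $\nabla_w\beta=\partial_w\beta+\Gamma_w\cdot\beta$, the dot
  -- being the action on forms.
  refine ⟨fderiv ℝ β y -
    (β y).fderivCompContinuousLinearMap (ContinuousLinearMap.id ℝ E) ∘L Γ, fun w => ?_, ?_⟩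
  · have h1 := map_fderiv_eq_of_eventually ((casimir e).restrictScalars ℝ)
      { toFun := fun θ => c • θ, map_add' := smul_add c, map_smul' := fun a θ => smul_comm c a θ }
      hγ hc w
    have h2 : casimir u (β y) = c • β y := by
      have h := hc.self_of_nhds
      rw [hu, casimir_compContinuousLinearMap u e (u : HSpace n →L[ℝ] E) (fun _ => rfl)] at h
      have h' := congrArg (fun θ => ContinuousAlternatingMap.compContinuousLinearMap θ
        (u.symm : E →L[ℝ] HSpace n)) h
      ext v
      simpa [Function.comp_def] using congrArg (fun θ => θ v) h'
    rw [hu] at h1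
    set γ' := (ContinuousAlternatingMap.compContinuousLinearMapCLM (u : HSpace n →L[ℝ] E) ∘L
      fderiv ℝ β y + (β y).fderivCompContinuousLinearMap (u : HSpace n →L[ℝ] E) ∘L
      fderiv ℝ s y) w with hγ'
    have h3 : casimir e γ' = c • γ' := h1
    -- The endomorphism `D` is $\nabla_ws$ read through the frame. Pulling the derivative `γ'` back
    -- by `u.symm` gives $\nabla_w\beta$ up to the action of `D`, which preserves the eigenspace by
    -- `hB`.
    set D : E →L[ℝ] E := fderiv ℝ s y w ∘L (u.symm : E →L[ℝ] HSpace n) + Γ w with hD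
    have h4 : (fderiv ℝ β y -
        (β y).fderivCompContinuousLinearMap (ContinuousLinearMap.id ℝ E) ∘L Γ) w =
        γ'.compContinuousLinearMap (u.symm : E →L[ℝ] HSpace n) + formAction D (β y) := by
      have h5 : γ'.compContinuousLinearMap (u.symm : E →L[ℝ] HSpace n) = fderiv ℝ β y w +
          ((β y).fderivCompContinuousLinearMap (u : HSpace n →L[ℝ] E)
            (fderiv ℝ s y w)).compContinuousLinearMap (u.symm : E →L[ℝ] HSpace n) := by
        ext v
        simp [hγ', Function.comp_def]
      rw [h5, fderivCompContinuousLinearMap_comp_symm, hD, formAction_add, sub_apply,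
        ContinuousLinearMap.comp_apply, fderivCompContinuousLinearMap_id]
      abel
    have h6 : casimir u (γ'.compContinuousLinearMap (u.symm : E →L[ℝ] HSpace n)) =
        c • γ'.compContinuousLinearMap (u.symm : E →L[ℝ] HSpace n) := by
      rw [casimir_compContinuousLinearMap e u (u.symm : E →L[ℝ] HSpace n)
        (fun v => u.symm_apply_apply v), h3]
      rfl
    have h7 : IsSpGLAlgebra fun v => u.symm (D (u v)) := by
      convert hB w using 4 with v
      simp [hD]
    rw [h4, map_add, h6, casimir_formAction_of_isSpGLAlgebra u D h7, h2, map_smul, smul_add]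
  -- The Christoffel term is killed by alternation because $\Gamma$ is symmetric.
  · rw [extDeriv, ← alternatizeUncurryFinCLM_apply (𝕜 := ℝ) (fderiv ℝ β y - _), map_sub,
      alternatizeUncurryFinCLM_apply, alternatizeUncurryFinCLM_apply,
      ContinuousAlternatingMap.alternatizeUncurryFin_fderivCompContinuousLinearMap_eq_zero _ _ hΓ,
      sub_zero]

end Calculus

/-! ### Christoffel symbols of a torsion-free connection at a point. -/

section Connection

variable {d : ℕ} {M : Type*} [TopologicalSpace M] [ChartedSpace (EuclideanSpace ℝ (Fin d)) M]
  [IsManifold (𝓡 d) ∞ M]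

/-- The expression of a vector field in the preferred chart at `x`. -/
def chartRep (x : M) (X : ∀ y : M, TangentSpace (𝓡 d) y) (z : EuclideanSpace ℝ (Fin d)) :
    EuclideanSpace ℝ (Fin d) :=
  (trivializationAt (EuclideanSpace ℝ (Fin d)) (TangentSpace (𝓡 d) : M → Type _) x
    ⟨(extChartAt (𝓡 d) x).symm z, X ((extChartAt (𝓡 d) x).symm z)⟩).2

omit [IsManifold (𝓡 d) ∞ M] in
theorem eventually_mem_extChartAt_target (x : M) :
    ∀ᶠ z in 𝓝 (extChartAt (𝓡 d) x x), z ∈ (extChartAt (𝓡 d) x).target :=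
  extChartAt_target_mem_nhds x

theorem chartRep_of_mem {x : M} (X : ∀ y : M, TangentSpace (𝓡 d) y)
    {z : EuclideanSpace ℝ (Fin d)} (hz : z ∈ (extChartAt (𝓡 d) x).target) :
    chartRep x X z = mfderiv (𝓡 d) 𝓘(ℝ, EuclideanSpace ℝ (Fin d)) (extChartAt (𝓡 d) x)
      ((extChartAt (𝓡 d) x).symm z) (X ((extChartAt (𝓡 d) x).symm z)) := by
  have h := (extChartAt (𝓡 d) x).map_target hz
  rw [extChartAt_source] at h
  have hb : (extChartAt (𝓡 d) x).symm z ∈ (trivializationAt (EuclideanSpace ℝ (Fin d))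
      (TangentSpace (𝓡 d) : M → Type _) x).baseSet := by simpa using h
  have h1 := Bundle.Trivialization.continuousLinearMapAt_apply_of_mem (R := ℝ) _ hb
    (X ((extChartAt (𝓡 d) x).symm z))
  have h2 := DFunLike.congr_fun (TangentBundle.continuousLinearMapAt_trivializationAt
    (I := 𝓡 d) h) (X ((extChartAt (𝓡 d) x).symm z))
  exact h1.symm.trans h2

theorem chartRep_self (x : M) (X : ∀ y : M, TangentSpace (𝓡 d) y) :
    chartRep x X (extChartAt (𝓡 d) x x) = X x := by
  rw [chartRep_of_mem X (mem_extChartAt_target x)]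
  rw [extChartAt_to_inv, mfderiv_extChartAt_self]
  rfl

/-- Differentiability of a vector field at a point. -/
abbrev DifferentiableFieldAt (X : ∀ y : M, TangentSpace (𝓡 d) y) (x : M) : Prop :=
  MDifferentiableAt (𝓡 d) ((𝓡 d).prod 𝓘(ℝ, EuclideanSpace ℝ (Fin d)))
    (fun y => (⟨y, X y⟩ :
      Bundle.TotalSpace (EuclideanSpace ℝ (Fin d)) (TangentSpace (𝓡 d) : M → Type _))) x

theorem differentiableAt_chartRep {x : M} {X : ∀ y : M, TangentSpace (𝓡 d) y}
    (hX : DifferentiableFieldAt X x) : DifferentiableAt ℝ (chartRep x X) (extChartAt (𝓡 d) x x) := by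
  have := ((_root_.mdifferentiableAt_section _ _).1 hX).differentiableWithinAt_writtenInExtChartAt
  rw [ModelWithCorners.range_eq_univ, differentiableWithinAt_univ] at this
  exact this

/-- The flat connection given at every point by the preferred chart there. -/
def chartConnection (X : ∀ y : M, TangentSpace (𝓡 d) y) (x : M) :
    TangentSpace (𝓡 d) x →L[ℝ] TangentSpace (𝓡 d) x :=
  fderiv ℝ (chartRep x X) (extChartAt (𝓡 d) x x)

theorem isCovariantDerivativeOn_chartConnection :
    IsCovariantDerivativeOn (I := 𝓡 d) (EuclideanSpace ℝ (Fin d))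
      (V := (TangentSpace (𝓡 d) : M → Type _)) chartConnection Set.univ where
  add {X Y x} hX hY _ := by
    have h : chartRep x (X + Y) =ᶠ[𝓝 (extChartAt (𝓡 d) x x)] chartRep x X + chartRep x Y := by
      filter_upwards [eventually_mem_extChartAt_target x] with z hz
      rw [Pi.add_apply, chartRep_of_mem _ hz, chartRep_of_mem _ hz, chartRep_of_mem _ hz]
      exact map_add _ _ _
    exact h.fderiv_eq.trans
      (fderiv_add (differentiableAt_chartRep hX) (differentiableAt_chartRep hY))
  leibniz {X g x} hX hg _ := by
    have h : chartRep x (g • X) =ᶠ[𝓝 (extChartAt (𝓡 d) x x)]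
        fun z => g ((extChartAt (𝓡 d) x).symm z) • chartRep x X z := by
      filter_upwards [eventually_mem_extChartAt_target x] with z hz
      rw [chartRep_of_mem _ hz, chartRep_of_mem _ hz]
      exact (mfderiv (𝓡 d) 𝓘(ℝ, EuclideanSpace ℝ (Fin d)) (extChartAt (𝓡 d) x)
        ((extChartAt (𝓡 d) x).symm z)).map_smul (g ((extChartAt (𝓡 d) x).symm z))
        (X ((extChartAt (𝓡 d) x).symm z))
    have hg' : DifferentiableAt ℝ (fun z => g ((extChartAt (𝓡 d) x).symm z))
        (extChartAt (𝓡 d) x x) := by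
      have := hg.differentiableWithinAt_writtenInExtChartAt
      rw [ModelWithCorners.range_eq_univ, differentiableWithinAt_univ] at this
      exact this
    have hdg : ∀ w, mvfderiv (𝓡 d) g x w =
        fderiv ℝ (fun z => g ((extChartAt (𝓡 d) x).symm z)) (extChartAt (𝓡 d) x x) w := by
      intro w
      have := hg.mfderiv
      rw [ModelWithCorners.range_eq_univ, fderivWithin_univ] at this
      exact DFunLike.congr_fun this w
    have h1 := h.fderiv_eq.trans (fderiv_fun_smul hg' (differentiableAt_chartRep hX))
    rw [chartRep_self, extChartAt_to_inv] at h1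
    refine h1.trans (ContinuousLinearMap.ext fun w => ?_)
    exact congrArg (fun t : ℝ => g x • chartConnection X x w + t • X x) (hdg w).symm

/-- The coordinate vector field with constant coefficients `e` in the preferred chart at `x`. -/
def coordField (x : M) (e : EuclideanSpace ℝ (Fin d)) (y : M) : TangentSpace (𝓡 d) y :=
  (trivializationAt (EuclideanSpace ℝ (Fin d)) (TangentSpace (𝓡 d) : M → Type _) x).symmL ℝ y e

theorem chartRep_coordField {x : M} (e : EuclideanSpace ℝ (Fin d))
    {z : EuclideanSpace ℝ (Fin d)} (hz : z ∈ (extChartAt (𝓡 d) x).target) :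
    chartRep x (coordField x e) z = e := by
  have h := (extChartAt (𝓡 d) x).map_target hz
  rw [extChartAt_source] at h
  have hb : (extChartAt (𝓡 d) x).symm z ∈ (trivializationAt (EuclideanSpace ℝ (Fin d))
      (TangentSpace (𝓡 d) : M → Type _) x).baseSet := by simpa using h
  rw [chartRep, ← Bundle.Trivialization.continuousLinearMapAt_apply_of_mem (R := ℝ) _ hb]
  exact Bundle.Trivialization.continuousLinearMapAt_symmL _ hb e

theorem coordField_self (x : M) (e : EuclideanSpace ℝ (Fin d)) : coordField x e x = e := by
  exact (chartRep_self x _).symm.trans (chartRep_coordField e (mem_extChartAt_target x))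

theorem mdifferentiableAt_coordField (x : M) (e : EuclideanSpace ℝ (Fin d)) :
    DifferentiableFieldAt (coordField x e) x := by
  rw [DifferentiableFieldAt, _root_.mdifferentiableAt_section]
  refine (mdifferentiableAt_const (c := e)).congr_of_eventuallyEq ?_
  filter_upwards [extChartAt_source_mem_nhds (I := 𝓡 d) x] with y hy
  have := chartRep_coordField e ((extChartAt (𝓡 d) x).map_source hy)
  rwa [chartRep, (extChartAt (𝓡 d) x).left_inv hy] at this

theorem chartConnection_coordField (x : M) (e : EuclideanSpace ℝ (Fin d)) :
    chartConnection (coordField x e) x = 0 := by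
  have h : chartRep x (coordField x e) =ᶠ[𝓝 (extChartAt (𝓡 d) x x)] fun _ => e := by
    filter_upwards [eventually_mem_extChartAt_target x] with z hz
    exact chartRep_coordField e hz
  have h0 : fderiv ℝ (fun _ : EuclideanSpace ℝ (Fin d) => e) (extChartAt (𝓡 d) x x) = 0 :=
    fderiv_const_apply e
  exact h.fderiv_eq.trans h0

theorem mlieBracket_coordField (x : M) (e f : EuclideanSpace ℝ (Fin d)) :
    VectorField.mlieBracket (𝓡 d) (coordField x e) (coordField x f) x = 0 := by
  have h : ∀ e : EuclideanSpace ℝ (Fin d), VectorField.mpullbackWithin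
      𝓘(ℝ, EuclideanSpace ℝ (Fin d)) (𝓡 d) (extChartAt (𝓡 d) x).symm (coordField x e)
      (Set.range (𝓡 d)) =ᶠ[𝓝 (extChartAt (𝓡 d) x x)] fun _ => e := by
    intro e
    filter_upwards [eventually_mem_extChartAt_target x] with z hz
    have h := (extChartAt (𝓡 d) x).map_target hz
    rw [extChartAt_source] at h
    rw [VectorField.mpullbackWithin_apply, coordField, TangentBundle.symmL_trivializationAt h,
      (extChartAt (𝓡 d) x).right_inv hz]
    exact (isInvertible_mfderivWithin_extChartAt_symm hz).inverse_apply_self e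
  have hd : ∀ (e : EuclideanSpace ℝ (Fin d)) (s : Set (EuclideanSpace ℝ (Fin d))),
      fderivWithin ℝ (VectorField.mpullbackWithin
        𝓘(ℝ, EuclideanSpace ℝ (Fin d)) (𝓡 d) (extChartAt (𝓡 d) x).symm (coordField x e)
        (Set.range (𝓡 d))) s (extChartAt (𝓡 d) x x) = 0 := fun e s =>
    (((h e).filter_mono nhdsWithin_le_nhds).fderivWithin_eq (h e).self_of_nhds).trans
      (fderivWithin_const_apply e)
  rw [VectorField.mlieBracket, VectorField.mlieBracketWithin_apply]
  refine (congrArg _ ?_).trans (map_zero _)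
  change fderivWithin ℝ _ _ _ _ - fderivWithin ℝ _ _ _ _ = (0 : EuclideanSpace ℝ (Fin d))
  rw [hd, hd]
  exact sub_self (0 : EuclideanSpace ℝ (Fin d))

/-- The difference of `cov` and the flat chart connection is tensorial at `x`. Coordinate fields are
parallel for the latter and have zero bracket at `x`, so vanishing torsion, tested on them, makes
the difference symmetric. -/
theorem exists_christoffel (cov : CovariantDerivative (𝓡 d) (EuclideanSpace ℝ (Fin d))
      (TangentSpace (𝓡 d) : M → Type _)) (hcov : cov.torsion = 0) (x : M) :
    ∃ Γ : EuclideanSpace ℝ (Fin d) →L[ℝ] EuclideanSpace ℝ (Fin d) →L[ℝ] EuclideanSpace ℝ (Fin d),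
      (∀ v w, Γ v w = Γ w v) ∧ ∀ X : ∀ y : M, TangentSpace (𝓡 d) y, DifferentiableFieldAt X x →
        ∀ w : EuclideanSpace ℝ (Fin d),
          cov X x w = fderiv ℝ (chartRep x X) (extChartAt (𝓡 d) x x) w + Γ w (X x) := by
  have h := fun (X : ∀ y : M, TangentSpace (𝓡 d) y) (hX : DifferentiableFieldAt X x) =>
    IsCovariantDerivativeOn.difference_apply (x := x) cov.isCovariantDerivativeOnUniv
    isCovariantDerivativeOn_chartConnection trivial hX
  let Γ : EuclideanSpace ℝ (Fin d) →L[ℝ] EuclideanSpace ℝ (Fin d) →L[ℝ] EuclideanSpace ℝ (Fin d) :=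
    IsCovariantDerivativeOn.difference cov.isCovariantDerivativeOnUniv
      isCovariantDerivativeOn_chartConnection x
  have hΓ : ∀ v w, Γ v w = Γ w v := by
    intro v w
    have hv := h _ (mdifferentiableAt_coordField x v)
    have hw := h _ (mdifferentiableAt_coordField x w)
    rw [chartConnection_coordField, sub_zero, coordField_self] at hv hw
    have ht := cov.torsion_eq_zero_iff.1 hcov (mdifferentiableAt_coordField x v)
      (mdifferentiableAt_coordField x w)
    rw [mlieBracket_coordField, sub_eq_zero, coordField_self, coordField_self, ← hv, ← hw] at ht
    exact ht.symm
  refine ⟨Γ, hΓ, fun X hX w => ?_⟩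
  have h1 := congrArg (fun T => T w) (h X hX)
  exact (eq_add_of_sub_eq h1.symm).trans ((add_comm _ _).trans
    (congrArg (fun t => fderiv ℝ (chartRep x X) (extChartAt (𝓡 d) x x) w + t) (hΓ (X x) w)))

end Connection

/-- Frames are smooth in the sense that each field `s v` is; this upgrades such differentiability to
that of an operator-valued map. -/
theorem differentiableAt_clm_of_apply {D F G : Type*} [NormedAddCommGroup D] [NormedSpace ℝ D]
    [NormedAddCommGroup F] [NormedSpace ℝ F] [FiniteDimensional ℝ F] [NormedAddCommGroup G]
    [NormedSpace ℝ G] {f : D → F →L[ℝ] G} {x : D}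
    (h : ∀ v, DifferentiableAt ℝ (fun z => f z v) x) : DifferentiableAt ℝ f x := by
  have hd : Module.finrank ℝ F = Module.finrank ℝ (Fin (Module.finrank ℝ F) → ℝ) :=
    (Module.finrank_fin_fun ℝ).symm
  let e₁ := ContinuousLinearEquiv.ofFinrankEq hd
  let e₂ := (e₁.arrowCongr (1 : G ≃L[ℝ] G)).trans
    (ContinuousLinearEquiv.piRing (Fin (Module.finrank ℝ F)))
  rw [← Function.id_comp f, ← e₂.symm_comp_self]
  exact e₂.symm.differentiableAt.comp x (differentiableAt_pi.2 fun i => h _)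

/-! ### The relation for $d\alpha$ and the formulas for its components. -/

namespace SpGLStructure

open ContinuousAlternatingMap (alternatizeUncurryFin)

variable {n k : ℕ} {M : Type*} [TopologicalSpace M]
  [ChartedSpace (EuclideanSpace ℝ (Fin (4 * n))) M] [IsManifold (𝓡 (4 * n)) ∞ M]
  (Q : SpGLStructure n M)

/-- A frame field seen in the preferred chart at `x`. -/
def chartFrame (x : M) (s : ∀ y : M, HSpace n ≃L[ℝ] TangentSpace (𝓡 (4 * n)) y)
    (z : EuclideanSpace ℝ (Fin (4 * n))) : HSpace n →L[ℝ] EuclideanSpace ℝ (Fin (4 * n)) :=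
  (mfderiv (𝓡 (4 * n)) 𝓘(ℝ, EuclideanSpace ℝ (Fin (4 * n))) (extChartAt (𝓡 (4 * n)) x)
    ((extChartAt (𝓡 (4 * n)) x).symm z)).comp
      (s ((extChartAt (𝓡 (4 * n)) x).symm z) : HSpace n →L[ℝ] TangentSpace (𝓡 (4 * n))
        ((extChartAt (𝓡 (4 * n)) x).symm z))

theorem chartFrame_apply {x : M} (s : ∀ y : M, HSpace n ≃L[ℝ] TangentSpace (𝓡 (4 * n)) y)
    {z : EuclideanSpace ℝ (Fin (4 * n))} (hz : z ∈ (extChartAt (𝓡 (4 * n)) x).target)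
    (v : HSpace n) : chartFrame x s z v = chartRep x (fun y => s y v) z :=
  (chartRep_of_mem (fun y => s y v) hz).symm

theorem inChart_compContinuousLinearMap_chartFrame {x : M} (α : ∀ x : M, Covector n k x)
    (s : ∀ y : M, HSpace n ≃L[ℝ] TangentSpace (𝓡 (4 * n)) y)
    {z : EuclideanSpace ℝ (Fin (4 * n))} (hz : z ∈ (extChartAt (𝓡 (4 * n)) x).target) :
    (inChart α x z).compContinuousLinearMap (chartFrame x s z) =
      (α ((extChartAt (𝓡 (4 * n)) x).symm z)).compContinuousLinearMap
        (s ((extChartAt (𝓡 (4 * n)) x).symm z) : HSpace n →L[ℝ] TangentSpace (𝓡 (4 * n))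
          ((extChartAt (𝓡 (4 * n)) x).symm z)) := by
  have h := mfderivWithin_extChartAt_symm_comp_mfderiv_extChartAt (I := 𝓡 (4 * n)) hz
  rw [ModelWithCorners.range_eq_univ, mfderivWithin_univ] at h
  ext v
  refine congrArg (α ((extChartAt (𝓡 (4 * n)) x).symm z)) (funext fun i => ?_)
  exact DFunLike.congr_fun h (s ((extChartAt (𝓡 (4 * n)) x).symm z) (v i))

theorem extD_eq_extDeriv (α : ∀ x : M, Covector n k x) (x : M) :
    extD α x = extDeriv (inChart α x) (extChartAt (𝓡 (4 * n)) x x) := by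
  ext v
  refine congrArg (extDeriv (inChart α x) (extChartAt (𝓡 (4 * n)) x x)) (funext fun i => ?_)
  exact DFunLike.congr_fun (mfderiv_extChartAt_self (I := 𝓡 (4 * n)) (x := x)) (v i)

theorem casimir_eq_of_mem_E {x : M} {u : HSpace n ≃L[ℝ] TangentSpace (𝓡 (4 * n)) x}
    (hu : u ∈ Q.frames x) {r : ℤ} {β : Covector n k x} (hβ : β ∈ Q.E k r x) :
    casimir u β = casimirValue r • β := by
  rw [Q.E_eq hu] at hβ
  exact Module.End.mem_eigenspace_iff.1 (isotypic_le_eigenspace u r hβ)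

/-- On a quaternionic manifold, the exterior derivative of a section of `E_{k,r}` has components
of weights `r + 1` and `r - 1` only. -/
theorem casimir_casimir_extD (hQ : Q.IsQuaternionic) {r : ℤ} {α : ∀ x : M, Covector n k x}
    (hα : Q.IsSmoothSection k r α) {x : M}
    {u : HSpace n ≃L[ℝ] TangentSpace (𝓡 (4 * n)) x} (hu : u ∈ Q.frames x) :
    casimir u (casimir u (extD α x)) =
      (casimirValue (r + 1) + casimirValue (r - 1)) • casimir u (extD α x) -
        (casimirValue (r + 1) * casimirValue (r - 1)) • extD α x := by
  obtain ⟨cov, -, htor, hpres⟩ := hQ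
  obtain ⟨Γ, hΓ, hcov⟩ := exists_christoffel cov htor x
  obtain ⟨U, hU, hxU, s, hs, hsm⟩ := Q.exists_section x
  obtain ⟨g, hg, rfl⟩ := (Q.mem_frames_iff x (s x) (hs x hxU) u).1 hu
  -- The given frame may be replaced by the value at `x` of a smooth local section, which can be
  -- differentiated.
  rw [casimir_trans (s x) g hg]
  set y := extChartAt (𝓡 (4 * n)) x x with hy
  let u₀ : HSpace n ≃L[ℝ] EuclideanSpace ℝ (Fin (4 * n)) := s x
  have hfield : ∀ v, DifferentiableFieldAt (fun y => s y v) x := fun v =>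
    ((hsm v).contMDiffAt (hU.mem_nhds hxU)).mdifferentiableAt (by simp)
  have hev : ∀ v, (fun z => chartFrame x s z v) =ᶠ[𝓝 y] chartRep x fun y => s y v := by
    intro v
    filter_upwards [eventually_mem_extChartAt_target x] with z hz
    exact chartFrame_apply s hz v
  have hdiff : DifferentiableAt ℝ (chartFrame x s) y := differentiableAt_clm_of_apply fun v =>
    (differentiableAt_chartRep (hfield v)).congr_of_eventuallyEq (hev v)
  have hfd : ∀ w v, fderiv ℝ (chartFrame x s) y w v =
      fderiv ℝ (chartRep x fun y => s y v) y w := by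
    intro w v
    rw [← (hev v).fderiv_eq]
    have := hdiff.hasFDerivAt.clm_apply (hasFDerivAt_const v y)
    rw [this.fderiv]
    simp
  have hβ : DifferentiableAt ℝ (inChart α x) y :=
    ((hα.1 x).contDiffAt (extChartAt_target_mem_nhds x)).differentiableAt (by simp)
  have hu₀ : chartFrame x s y = u₀ := by
    ext1 v
    rw [chartFrame_apply s (mem_extChartAt_target x), chartRep_self]
    rfl
  have hsymm : ∀ᶠ z in 𝓝 y, (extChartAt (𝓡 (4 * n)) x).symm z ∈ U :=
    (continuousAt_extChartAt_symm x).eventually_mem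
      (by rw [extChartAt_to_inv]; exact hU.mem_nhds hxU)
  have hc : ∀ᶠ z in 𝓝 y, casimir (ContinuousLinearEquiv.refl ℝ (HSpace n))
      ((inChart α x z).compContinuousLinearMap (chartFrame x s z)) =
        casimirValue r • (inChart α x z).compContinuousLinearMap (chartFrame x s z) := by
    filter_upwards [eventually_mem_extChartAt_target x, hsymm] with z hz hzU
    rw [inChart_compContinuousLinearMap_chartFrame α s hz, casimir_compContinuousLinearMap
      (s ((extChartAt (𝓡 (4 * n)) x).symm z)) _ _ (fun _ => rfl),
      Q.casimir_eq_of_mem_E (hs _ hzU) (hα.2 _)]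
    rfl
  have hB : ∀ w, IsSpGLAlgebra fun v =>
      u₀.symm (fderiv ℝ (chartFrame x s) y w v + Γ w (u₀ v)) := by
    intro w
    have h := hpres U s hU hs hsm x hxU w
    have heq : (fun v => (s x).symm (cov (fun y => s y v) x w)) = fun v =>
        u₀.symm (fderiv ℝ (chartFrame x s) y w v + Γ w (u₀ v)) := by
      funext v
      rw [hfd]
      exact congrArg u₀.symm (hcov _ (hfield v) w)
    rwa [heq] at h
  obtain ⟨ψ, hψ, hd⟩ := exists_extDeriv_eq_alternatizeUncurryFin u₀ hu₀ hβ hdiff hc Γ hΓ hB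
  rw [extD_eq_extDeriv, ← hy, hd]
  exact casimir_casimir_alternatizeUncurryFin u₀ hψ

/-- The formulas for the components of a covector annihilated by `(C - c₊)(C - c₋)`. -/
theorem proj_eq_of_casimir_casimir {x : M}
    {u : HSpace n ≃L[ℝ] TangentSpace (𝓡 (4 * n)) x} (hu : u ∈ Q.frames x) (r : ℕ)
    (η : Covector n k x)
    (h : casimir u (casimir u η) =
      (casimirValue (r + 1) + casimirValue (r - 1)) • casimir u η -
        (casimirValue (r + 1) * casimirValue (r - 1)) • η) :
    Q.proj k (r + 1) x η = -(1 / 4 : ℂ) •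
        (((r : ℂ) - 1) • η + (1 / ((r : ℂ) + 1)) • casimir u η) ∧
      Q.proj k (r - 1) x η = (1 / 4 : ℂ) •
        (((r : ℂ) + 3) • η + (1 / ((r : ℂ) + 1)) • casimir u η) := by
  have hr : (r : ℂ) + 1 ≠ 0 := by exact_mod_cast r.succ_ne_zero
  -- These are $(C-c_-)\eta/(c_+-c_-)$ and, for `q`, $(C-c_+)\eta/(c_--c_+)$. By the quadratic
  -- relation they are eigenvectors for $c_+$ and $c_-$, and they add up to `η`.
  set p : Covector n k x := -(1 / 4 : ℂ) •
    (((r : ℂ) - 1) • η + (1 / ((r : ℂ) + 1)) • casimir u η) with hp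
  set q : Covector n k x := (1 / 4 : ℂ) •
    (((r : ℂ) + 3) • η + (1 / ((r : ℂ) + 1)) • casimir u η) with hq
  have hsum : p + q = η := by
    rw [hp, hq]
    module
  simp only [casimirValue] at h
  push_cast at h
  have hpC : casimir u p = casimirValue (r + 1) • p := by
    rw [hp, map_smul, map_add, map_smul, map_smul, h, casimirValue]
    push_cast
    match_scalars <;> field_simp <;> ring
  have hqC : casimir u q = casimirValue (r - 1) • q := by
    rw [hq, map_smul, map_add, map_smul, map_smul, h, casimirValue]
    push_cast
    match_scalars <;> field_simp <;> ring
  have hpE : p ∈ Q.E k (r + 1) x := by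
    rw [Q.E_eq hu, isotypic_of_nonneg u (by positivity)]
    exact Module.End.mem_eigenspace_iff.2 hpC
  have hqE : q ∈ Q.E k (r - 1) x := by
    -- For `r = 0` the target $E_{k,-1}$ is zero while $c_-=1$, so `q` vanishes because $1$ is not
    -- an eigenvalue.
    rcases Nat.eq_zero_or_pos r with rfl | hr'
    · have h1 : q ∈ Module.End.eigenspace (casimir u : Covector n k x →ₗ[ℂ] _) 1 := by
        refine Module.End.mem_eigenspace_iff.2 (hqC.trans ?_)
        norm_num [casimirValue]
      rw [eigenspace_casimir_one, Submodule.mem_bot] at h1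
      rw [h1]
      exact Submodule.zero_mem _
    · rw [Q.E_eq hu, isotypic_of_nonneg u (by omega)]
      exact Module.End.mem_eigenspace_iff.2 hqC
  constructor
  · conv_lhs => rw [← hsum]
    exact Q.proj_add_of_mem (by omega) hpE hqE
  · conv_lhs => rw [← hsum, add_comm]
    exact Q.proj_add_of_mem (by omega) hqE hpE

end SpGLStructure

end QuaternionicForms

end

theorem lemma4p7 {n : ℕ} {M : Type*} [TopologicalSpace M]
    [ChartedSpace (EuclideanSpace ℝ (Fin (4 * n))) M] [IsManifold (𝓡 (4 * n)) ∞ M]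
    (Q : QuaternionicForms.SpGLStructure n M) (hQ : Q.IsQuaternionic)
    (k r : ℕ) (α : ∀ x : M, QuaternionicForms.Covector n k x)
    (hα : Q.IsSmoothSection k r α) :
    -- the projections that define the two operators are honest projections
    (∀ (x : M) (s : ℤ), Q.Splits (k + 1) s x) ∧
    -- the formulas, with the Casimir operator computed in any frame of the structure
    ∀ (x : M), ∀ u ∈ Q.frames x,
      Q.D r α x = -(1 / 4 : ℂ) •
        (((r : ℂ) - 1) • QuaternionicForms.extD α x +
          (1 / ((r : ℂ) + 1)) • QuaternionicForms.casimir u (QuaternionicForms.extD α x)) ∧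
      Q.Dbar r α x = (1 / 4 : ℂ) •
        (((r : ℂ) + 3) • QuaternionicForms.extD α x +
          (1 / ((r : ℂ) + 1)) • QuaternionicForms.casimir u (QuaternionicForms.extD α x)) := by
  refine ⟨fun x s => Q.splits s x, fun x u hu => ?_⟩
  exact Q.proj_eq_of_casimir_casimir hu r _ (Q.casimir_casimir_extD hQ hα hu)
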